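/- Let $$\Xi_G=\Bigl\{x=\sum_{k=1}^\infty x_k2^{-k}:\ x_k\in\{0,1\},\ x_kx_{2k}=0\text{ for all }k\ge1\Bigr\}\subset[0,1].$$ For a function $\varphi\ge 0$ defined on some interval $[0,\varepsilon)$, let $\mathcal H^{\varphi}$ denote the generalized Hausdorff measure on $\mathbb R$ with gauge $\varphi$, that is, $\mathcal H^{\varphi}(A)=\lim_{r\to0}\inf\bigl\{\sum_i\varphi(\operatorname{diam}U_i):A\subset\bigcup_iU_i,\ \operatorname{diam}U_i\le r\bigr\}$ (countable covers), and let $\mathcal H^s$ be the $s$-dimensional Hausdorff measure. Let $0<p<1$ be the solution of $p^3=(1-p)^2$ and let $s=\dim_H\Xi_G$ be the Hausdorff dimension. Then $s=-\log_2p$, and the following hold. (i) $\mathcal H^s(\Xi_G)=\infty$, and $\Xi_G$ is not $\sigma$-finite with respect to $\mathcal H^s$. Moreover, there is $c_0>0$ such that for every $0<c<c_0$ and the gauge $$\phi(t)=t^s\exp\Bigl[-c\,\frac{|\log t|}{(\log|\log t|)^2}\Bigr]\quad(t>0\text{ small}),\qquad \phi(0)=0,$$ we have $\mathcal H^{\phi}(\Xi_G)=\infty$,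 and $\Xi_G$ is not $\sigma$-finite with respect to $\mathcal H^{\phi}$. (ii) For every real $\theta<2$ and the gauge $$\psi_\theta(t)=t^s\exp\Bigl[-\frac{|\log t|}{(\log|\log t|)^\theta}\Bigr]\quad(t>0\text{ small}),\qquad \psi_\theta(0)=0,$$ we have $\mathcal H^{\psi_\theta}(\Xi_G)=0$. -/

import Mathlib

open MeasureTheory

/-- The multiplicative golden mean shift: the reals `x = ∑_{k ≥ 1} a_k 2^{-k}` with digits
`a_k ∈ {0, 1}` such that `a_k a_{2k} = 0` for all `k ≥ 1`. (The value `a 0` plays no role.) -/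
def XiG : Set ℝ :=
  {x | ∃ a : ℕ → ℕ, (∀ k, a k = 0 ∨ a k = 1) ∧ (∀ k, 1 ≤ k → a k * a (2 * k) = 0) ∧
    HasSum (fun k : ℕ => (a (k + 1) : ℝ) / 2 ^ (k + 1)) x}

/-- The generalized Hausdorff measure `ℋ^φ` on `ℝ` with gauge `φ`: the limit, as `r → 0`, of the
infima of `∑ φ (diam Uᵢ)` over countable covers by sets `Uᵢ` of diameter at most `r`. It depends
only on the values of `φ` on an arbitrarily small interval `[0, ε)`. -/
noncomputable def gaugeMeasure (φ : ℝ → ℝ) : Measure ℝ :=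
  Measure.mkMetric fun d : ENNReal => ENNReal.ofReal (φ d.toReal)

/-- `φ(t) = t^s exp[-c |log t| / (log |log t|)^2]`. -/
noncomputable def phiGauge (s c t : ℝ) : ℝ :=
  t ^ s * Real.exp (-c * (|Real.log t| / (Real.log |Real.log t|) ^ 2))

/-- `ψ_θ(t) = t^s exp[-|log t| / (log |log t|)^θ]`. -/
noncomputable def psiGauge (s θ t : ℝ) : ℝ :=
  t ^ s * Real.exp (-(|Real.log t| / (Real.log |Real.log t|) ^ θ))

/-!
Let the digits be random, an unblocked position `k` carrying a one with probability `h k`. The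
entropy of the first `n` digits is then affine in their means, up to a quadratic cost in the
deviation of `h` from `1 - p`: at `h = 1 - p` the growth rate is `-log p`, and a mean density that
increases from one dyadic block to the next is rewarded to first order.

Lower bound: let the mean density of the `l`-th dyadic block be `η / (l + 6)` below the stationary
one. Its increments, of order `η / l ^ 2`, beat the cost, of order `η ^ 2 / l ^ 2`, when `η` is
small, so the entropy exceeds `-n log p` by a multiple of `n / (log n) ^ 2`. The variance being
`O(n log n)`, this holds almost surely along the squares, and the mass distribution principle makes
`ℋ^φ` positive for all small `c`; comparing `c` with a larger `c'` excludes `σ`-finiteness.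

Upper bound: fix a golden sequence. If for almost all `m` its prefix of length `2 ^ m` had
probability below `exp (2 ^ m (log p - C / m ^ 2))` under both constant biases `1 - p ± K / m`, then
the deviation of its density from the stationary one would satisfy a Riccati inequality without
bounded solutions. So infinitely often one of the two biases makes the prefix likely; there are few
likely prefixes, and their intervals cover `Ξ_G` infinitely often.
-/

open MeasureTheory ProbabilityTheory Filter Topology
open scoped ENNReal NNReal

/-- A golden sequence: a binary sequence with no two ones at positions `k` and `2 * k`. Including
`k = 0` normalises the irrelevant digit `a 0` to zero. -/
def IsGolden (a : ℕ → Bool) : Prop := ∀ k, a k = true → a (2 * k) = false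

/-- The position `k` is forced to carry a zero by a one at `k / 2`. -/
def Blocked (a : ℕ → Bool) (k : ℕ) : Prop := Even k ∧ a (k / 2) = true

instance (a : ℕ → Bool) (k : ℕ) : Decidable (Blocked a k) :=
  inferInstanceAs (Decidable (_ ∧ _))

/-- The golden digit sequence driven by free bits `b`: a bit is erased where it is blocked. -/
def goldenDigit (b : ℕ → Bool) : ℕ → Bool
  | 0 => false
  | k + 1 => b (k + 1) && !(decide (Even (k + 1)) && goldenDigit b ((k + 1) / 2))
decreasing_by omega

/-- The digit `a k` as a real number. -/
def digitVal (a : ℕ → Bool) (k : ℕ) : ℝ := if a k = true then 1 else 0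

/-- The sequence carrying `f m` at position `2 * m` and zero at odd positions: the influence of the
digits `f` on the positions that they may block. -/
def spread {M : Type*} [Zero M] (f : ℕ → M) (k : ℕ) : M := if Even k then f (k / 2) else 0

lemma IsGolden.apply_zero {a : ℕ → Bool} (ha : IsGolden a) : a 0 = false := by
  by_contra h
  exact h (ha 0 (Bool.eq_true_of_not_eq_false h))

lemma IsGolden.eq_false_of_blocked {a : ℕ → Bool} (ha : IsGolden a) {k : ℕ} (h : Blocked a k) :
    a k = false := by
  simpa only [Nat.mul_div_cancel' h.1.two_dvd] using ha (k / 2) h.2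

@[simp]
lemma goldenDigit_zero (b : ℕ → Bool) : goldenDigit b 0 = false := by rw [goldenDigit]

lemma goldenDigit_eq (b : ℕ → Bool) {k : ℕ} (hk : k ≠ 0) :
    goldenDigit b k = (b k && !decide (Blocked (goldenDigit b) k)) := by
  obtain ⟨k, rfl⟩ := Nat.exists_eq_succ_of_ne_zero hk
  have hblocked : decide (Blocked (goldenDigit b) (k + 1)) =
      (decide (Even (k + 1)) && goldenDigit b ((k + 1) / 2)) := by
    rw [Bool.eq_iff_iff, decide_eq_true_iff]
    simp [Blocked]
  rw [Nat.succ_eq_add_one, hblocked, goldenDigit]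

lemma isGolden_goldenDigit (b : ℕ → Bool) : IsGolden (goldenDigit b) := by
  intro k hk
  rcases eq_or_ne k 0 with rfl | hk0
  · simp
  · have hblocked : Blocked (goldenDigit b) (2 * k) := ⟨even_two_mul k, by simpa using hk⟩
    simp [goldenDigit_eq b (show 2 * k ≠ 0 by omega), hblocked]

lemma goldenDigit_prefix_eq_iff {a : ℕ → Bool} (ha : IsGolden a) (b : ℕ → Bool) (n : ℕ) :
    (∀ k ≤ n, goldenDigit b k = a k) ↔ ∀ k ∈ Finset.Icc 1 n, ¬ Blocked a k → b k = a k := by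
  induction n with
  | zero => simp [ha.apply_zero]
  | succ n ih =>
    have hnext (hn : ∀ k ≤ n, goldenDigit b k = a k) :
        goldenDigit b (n + 1) = a (n + 1) ↔ (¬ Blocked a (n + 1) → b (n + 1) = a (n + 1)) := by
      have hblocked : Blocked (goldenDigit b) (n + 1) ↔ Blocked a (n + 1) := by
        rw [Blocked, Blocked, hn _ (by omega)]
      by_cases h : Blocked a (n + 1)
      · simp [goldenDigit_eq, hblocked, h, ha.eq_false_of_blocked h]
      · simp [goldenDigit_eq, hblocked, h]
    simp only [Nat.le_add_one_iff, or_imp, forall_and, forall_eq,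
      ← Finset.insert_Icc_right_eq_Icc_add_one (show 1 ≤ n + 1 by omega),
      Finset.forall_mem_insert, ← ih]
    tauto

lemma digitVal_mem_Icc (a : ℕ → Bool) (k : ℕ) : digitVal a k ∈ Set.Icc (0 : ℝ) 1 := by
  unfold digitVal
  split_ifs <;> simp

lemma spread_digitVal (a : ℕ → Bool) (k : ℕ) :
    spread (digitVal a) k = if Blocked a k then 1 else 0 := by
  by_cases hk : Even k <;> simp [spread, digitVal, Blocked, hk]

lemma digitVal_goldenDigit_eq (b : ℕ → Bool) {k : ℕ} (hk : k ≠ 0) :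
    digitVal (goldenDigit b) k = digitVal b k * (1 - spread (digitVal (goldenDigit b)) k) := by
  simp only [spread_digitVal, digitVal, goldenDigit_eq b hk]
  by_cases h : Blocked (goldenDigit b) k <;> simp [h]

lemma spread_mem_Icc {x : ℕ → ℝ} (hx : ∀ k, x k ∈ Set.Icc (0 : ℝ) 1) (k : ℕ) :
    spread x k ∈ Set.Icc (0 : ℝ) 1 := by
  unfold spread
  split_ifs
  exacts [hx _, by simp]

@[simp]
lemma spread_two_mul {M : Type*} [Zero M] (f : ℕ → M) (m : ℕ) : spread f (2 * m) = f m := by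
  simp [spread]

@[simp]
lemma spread_two_mul_add_one {M : Type*} [Zero M] (f : ℕ → M) (m : ℕ) :
    spread f (2 * m + 1) = 0 := by
  simp [spread]

lemma sum_Icc_spread {M : Type*} [AddCommMonoid M] (f : ℕ → M) (n : ℕ) :
    ∑ k ∈ Finset.Icc 1 n, spread f k = ∑ m ∈ Finset.Icc 1 (n / 2), f m := by
  induction n with
  | zero => simp
  | succ n ih =>
    rw [Finset.sum_Icc_succ_top (by omega), ih]
    rcases Nat.even_or_odd' n with ⟨m, rfl | rfl⟩
    · rw [spread_two_mul_add_one, add_zero, show (2 * m + 1) / 2 = 2 * m / 2 by omega]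
    · rw [show 2 * m + 1 + 1 = 2 * (m + 1) by ring, spread_two_mul,
        Nat.mul_div_cancel_left _ two_pos, Finset.sum_Icc_succ_top (by omega),
        show (2 * m + 1) / 2 = m by omega]

/-- The surprisal of the first `n` entries of `x` under the biases `h`. For a golden digit sequence
it is minus the logarithm of the probability of the prefix when an unblocked position `k` carries a
one with probability `h k`; being affine in `x`, it makes sense for the expected digits as well. -/
noncomputable def surprisal (h x : ℕ → ℝ) (n : ℕ) : ℝ :=
  ∑ k ∈ Finset.Icc 1 n,
    ((1 - spread x k) * -Real.log (1 - h k) + x k * (Real.log (1 - h k) - Real.log (h k)))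

lemma IsGolden.surprisal_digitVal {a : ℕ → Bool} (ha : IsGolden a) (h : ℕ → ℝ) (n : ℕ) :
    surprisal h (digitVal a) n = ∑ k ∈ Finset.Icc 1 n with ¬ Blocked a k,
      -Real.log (if a k = true then h k else 1 - h k) := by
  rw [surprisal, Finset.sum_filter]
  refine Finset.sum_congr rfl fun k _ => ?_
  rw [spread_digitVal]
  by_cases hk : Blocked a k
  · simp [hk, digitVal, ha.eq_false_of_blocked hk]
  · cases hak : a k <;> simp [hk, digitVal, hak]
    ring

/-- The weight of the `k`-th entry in the surprisal of `n` entries: an entry in the first half also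
decides whether position `2 * k` is blocked. -/
noncomputable def surprisalWeight (h : ℕ → ℝ) (n k : ℕ) : ℝ :=
  Real.log (1 - h k) - Real.log (h k) + if k ≤ n / 2 then Real.log (1 - h (2 * k)) else 0

lemma surprisal_eq_sum_weight_mul (h x : ℕ → ℝ) (n : ℕ) :
    surprisal h x n = ∑ k ∈ Finset.Icc 1 n, -Real.log (1 - h k) +
      ∑ k ∈ Finset.Icc 1 n, surprisalWeight h n k * x k := by
  have hspread : ∑ k ∈ Finset.Icc 1 n, spread x k * Real.log (1 - h k) =
      ∑ k ∈ Finset.Icc 1 n, (if k ≤ n / 2 then Real.log (1 - h (2 * k)) else 0) * x k := by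
    calc _ = ∑ k ∈ Finset.Icc 1 n, spread (fun m => x m * Real.log (1 - h (2 * m))) k := by
          refine Finset.sum_congr rfl fun k _ => ?_
          rcases Nat.even_or_odd' k with ⟨m, rfl | rfl⟩ <;> simp
      _ = ∑ k ∈ Finset.Icc 1 n with k ≤ n / 2, Real.log (1 - h (2 * k)) * x k := by
          rw [sum_Icc_spread]
          refine Finset.sum_congr ?_ fun _ _ => mul_comm _ _
          ext k
          simp only [Finset.mem_filter, Finset.mem_Icc]
          omega
      _ = _ := by simp only [Finset.sum_filter, ite_mul, zero_mul]
  simp only [surprisal, surprisalWeight, add_mul, Finset.sum_add_distrib]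
  simp only [← hspread, ← Finset.sum_add_distrib]
  exact Finset.sum_congr rfl fun k _ => by ring

lemma abs_surprisalWeight_le {h : ℕ → ℝ} {W : ℝ} (hW : ∀ k, |Real.log (h k)| ≤ W)
    (hW' : ∀ k, |Real.log (1 - h k)| ≤ W) (n k : ℕ) : |surprisalWeight h n k| ≤ 3 * W := by
  have h1 := abs_le.1 (hW k)
  have h2 := abs_le.1 (hW' k)
  have h3 := abs_le.1 (hW' (2 * k))
  unfold surprisalWeight
  rw [abs_le]
  split_ifs <;> constructor <;> linarith

section DependsOn

variable {ι : Type*} {X : ι → Type*} [∀ i, MeasurableSpace (X i)] [∀ i, Countable (X i)]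
  [∀ i, MeasurableSingletonClass (X i)] {β γ : Type*} [MeasurableSpace β] [Nonempty β]
  [MeasurableSpace γ] [Nonempty γ] {f : (∀ i, X i) → β} {g : (∀ i, X i) → γ} {S T : Finset ι}

lemma measurable_of_dependsOn (hf : DependsOn f (S : Set ι)) : Measurable f := by
  obtain ⟨φ, rfl⟩ := dependsOn_iff_exists_comp.1 hf
  exact (measurable_of_countable φ).comp (by fun_prop)

lemma indepFun_infinitePi_of_dependsOn (μ : ∀ i, Measure (X i)) [∀ i, IsProbabilityMeasure (μ i)]
    (hf : DependsOn f (S : Set ι)) (hg : DependsOn g (T : Set ι)) (hST : Disjoint S T) :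
    IndepFun f g (Measure.infinitePi μ) := by
  obtain ⟨φ, rfl⟩ := dependsOn_iff_exists_comp.1 hf
  obtain ⟨ψ, rfl⟩ := dependsOn_iff_exists_comp.1 hg
  have hcoord : iIndepFun (fun i (x : ∀ i, X i) => x i) (Measure.infinitePi μ) :=
    iIndepFun_infinitePi (X := fun _ x => x) fun _ => measurable_id
  exact (hcoord.indepFun_finset S T hST measurable_pi_apply).comp
    (measurable_of_countable φ) (measurable_of_countable ψ)

end DependsOn

lemma abs_covariance_le_of_mem_Icc {Ω : Type*} {mΩ : MeasurableSpace Ω} {μ : Measure Ω}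
    [IsProbabilityMeasure μ] {X Y : Ω → ℝ} {a b c d : ℝ} (hXm : AEMeasurable X μ)
    (hYm : AEMeasurable Y μ) (hX : ∀ ω, X ω ∈ Set.Icc a b) (hY : ∀ ω, Y ω ∈ Set.Icc c d) :
    |cov[X, Y; μ]| ≤ (b - a) * (d - c) := by
  have hmeanX : μ[X] ∈ Set.Icc a b := (convex_Icc a b).integral_mem isClosed_Icc
    (ae_of_all _ hX) (.of_mem_Icc a b hXm (ae_of_all _ hX))
  have hmeanY : μ[Y] ∈ Set.Icc c d := (convex_Icc c d).integral_mem isClosed_Icc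
    (ae_of_all _ hY) (.of_mem_Icc c d hYm (ae_of_all _ hY))
  have hbound (ω : Ω) : ‖(X ω - μ[X]) * (Y ω - μ[Y])‖ ≤ (b - a) * (d - c) := by
    rw [norm_mul]
    exact mul_le_mul (abs_sub_le_of_le_of_le (hX ω).1 (hX ω).2 hmeanX.1 hmeanX.2)
      (abs_sub_le_of_le_of_le (hY ω).1 (hY ω).2 hmeanY.1 hmeanY.2) (norm_nonneg _)
      (by linarith [(hX ω).1, (hX ω).2])
  simpa [covariance] using norm_integral_le_of_norm_le_const (ae_of_all μ hbound)

/-- Independent bits, the `k`-th one being `true` with probability `h k`. -/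
noncomputable def bitMeasure (h : ℕ → unitInterval) : Measure (ℕ → Bool) :=
  Measure.infinitePi fun k => bernoulliMeasure true false (h k)

instance (h : ℕ → unitInterval) : IsProbabilityMeasure (bitMeasure h) := by
  unfold bitMeasure
  infer_instance

lemma bernoulliMeasure_bool_singleton (p : unitInterval) (c : Bool) :
    bernoulliMeasure true false p {c} = ENNReal.ofReal (if c = true then (p : ℝ) else 1 - p) := by
  rw [bernoulliMeasure_apply _ (measurableSet_singleton c)]
  cases c <;> simp [ENNReal.ofReal, Real.toNNReal_of_nonneg, p.2.1, p.2.2] <;> rfl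

lemma bitMeasure_goldenDigit_prefix {h : ℕ → unitInterval} (hh : ∀ k, (h k : ℝ) ∈ Set.Ioo 0 1)
    {a : ℕ → Bool} (ha : IsGolden a) (n : ℕ) :
    bitMeasure h {b | ∀ k ≤ n, goldenDigit b k = a k} =
      ENNReal.ofReal (Real.exp (-surprisal (fun k => h k) (digitVal a) n)) := by
  have hcylinder : {b | ∀ k ≤ n, goldenDigit b k = a k} =
      Set.pi (({k ∈ Finset.Icc 1 n | ¬ Blocked a k} : Finset ℕ) : Set ℕ) fun k => {a k} := by
    ext b
    simp [goldenDigit_prefix_eq_iff ha, Set.mem_pi]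
  rw [hcylinder, bitMeasure, Measure.infinitePi_pi _ fun _ _ => measurableSet_singleton _,
    ha.surprisal_digitVal, ← Finset.sum_neg_distrib, Real.exp_sum,
    ENNReal.ofReal_prod_of_nonneg fun _ _ => (Real.exp_pos _).le]
  refine Finset.prod_congr rfl fun k _ => ?_
  have hpos : 0 < if a k = true then (h k : ℝ) else 1 - h k := by
    split_ifs
    exacts [(hh k).1, sub_pos.2 (hh k).2]
  rw [bernoulliMeasure_bool_singleton, neg_neg, Real.exp_log hpos]

/-- The positions at most `k` with the same odd part as `k`: only their bits influence the golden
digit at `k`. -/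
def chainTo (k : ℕ) : Finset ℕ := {j ∈ Finset.Icc 1 k | ordCompl[2] j = ordCompl[2] k}

lemma chainTo_subset_chainTo_two_mul (m : ℕ) : chainTo m ⊆ chainTo (2 * m) := by
  intro j hj
  simp only [chainTo, Finset.mem_filter, Finset.mem_Icc] at hj ⊢
  refine ⟨by omega, hj.2.trans ?_⟩
  simp [Nat.ordCompl_mul, Nat.prime_two.factorization_self]

lemma dependsOn_goldenDigit (k : ℕ) :
    DependsOn (fun b => goldenDigit b k) (chainTo k : Set ℕ) := by
  induction k using Nat.strong_induction_on with
  | _ k ih =>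
    intro b b' hbb'
    rcases eq_or_ne k 0 with rfl | hk
    · simp
    have hbit : b k = b' k := hbb' k (by simp [chainTo]; omega)
    have hblocked : Blocked (goldenDigit b) k ↔ Blocked (goldenDigit b') k := by
      refine and_congr_right fun heven => ?_
      obtain ⟨m, rfl⟩ := heven.two_dvd
      rw [Nat.mul_div_cancel_left m two_pos]
      exact Bool.eq_iff_iff.1 <| ih m (by omega) fun i hi =>
        hbb' i (Finset.coe_subset.2 (chainTo_subset_chainTo_two_mul m) hi)
    simp [goldenDigit_eq _ hk, hbit, hblocked]

lemma dependsOn_digitVal_goldenDigit (k : ℕ) :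
    DependsOn (fun b => digitVal (goldenDigit b) k) (chainTo k : Set ℕ) := fun _ _ hbb' =>
  congrArg (fun c : Bool => if c = true then (1 : ℝ) else 0) (dependsOn_goldenDigit k hbb')

lemma measurable_digitVal_goldenDigit (k : ℕ) :
    Measurable fun b => digitVal (goldenDigit b) k :=
  measurable_of_dependsOn (dependsOn_digitVal_goldenDigit k)

lemma memLp_digitVal_goldenDigit (h : ℕ → unitInterval) (k : ℕ) (q : ℝ≥0∞) :
    MemLp (fun b => digitVal (goldenDigit b) k) q (bitMeasure h) :=
  memLp_of_bounded (ae_of_all _ fun _ => digitVal_mem_Icc _ k)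
    (measurable_digitVal_goldenDigit k).aestronglyMeasurable q

lemma indepFun_digitVal_goldenDigit (h : ℕ → unitInterval) {j k : ℕ}
    (hjk : ordCompl[2] j ≠ ordCompl[2] k) :
    IndepFun (fun b => digitVal (goldenDigit b) j) (fun b => digitVal (goldenDigit b) k)
      (bitMeasure h) := by
  refine indepFun_infinitePi_of_dependsOn _ (dependsOn_digitVal_goldenDigit j)
    (dependsOn_digitVal_goldenDigit k) (Finset.disjoint_left.2 fun i hi hi' => hjk ?_)
  exact (Finset.mem_filter.1 hi).2.symm.trans (Finset.mem_filter.1 hi').2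

/-- The expected value of the golden digit at `k` when the free bits have biases `h`. -/
noncomputable def meanDigit (h : ℕ → ℝ) : ℕ → ℝ
  | 0 => 0
  | k + 1 => h (k + 1) * (1 - if Even (k + 1) then meanDigit h ((k + 1) / 2) else 0)
decreasing_by omega

lemma meanDigit_zero (h : ℕ → ℝ) : meanDigit h 0 = 0 := by rw [meanDigit]

lemma meanDigit_eq (h : ℕ → ℝ) {k : ℕ} (hk : k ≠ 0) :
    meanDigit h k = h k * (1 - spread (meanDigit h) k) := by
  obtain ⟨k, rfl⟩ := Nat.exists_eq_succ_of_ne_zero hk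
  rw [meanDigit]
  rfl

lemma meanDigit_mem_Icc {h : ℕ → ℝ} (hh : ∀ k, h k ∈ Set.Icc (0 : ℝ) 1) (k : ℕ) :
    meanDigit h k ∈ Set.Icc (0 : ℝ) 1 := by
  induction k using Nat.strong_induction_on with
  | _ k ih =>
    rcases eq_or_ne k 0 with rfl | hk
    · simp [meanDigit_zero]
    have hspread : spread (meanDigit h) k ∈ Set.Icc (0 : ℝ) 1 := by
      unfold spread
      split_ifs
      exacts [ih _ (by omega), by simp]
    rw [meanDigit_eq h hk]
    exact unitInterval.mul_mem (hh k) (Set.Icc.mem_iff_one_sub_mem.1 hspread)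

lemma integral_digitVal (h : ℕ → unitInterval) (k : ℕ) :
    ∫ b, digitVal b k ∂bitMeasure h = h k := by
  calc ∫ b, digitVal b k ∂bitMeasure h
      = ∫ c, (if c = true then (1 : ℝ) else 0) ∂((bitMeasure h).map fun b => b k) :=
        (integral_map (φ := fun b : ℕ → Bool => b k) (measurable_pi_apply k).aemeasurable
          (f := fun c => if c = true then (1 : ℝ) else 0)
          (measurable_of_countable _).aestronglyMeasurable).symm
    _ = h k := by
        rw [bitMeasure, Measure.infinitePi_map_eval, integral_bernoulliMeasure]
        simp

lemma integral_digitVal_goldenDigit (h : ℕ → unitInterval) (k : ℕ) :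
    ∫ b, digitVal (goldenDigit b) k ∂bitMeasure h = meanDigit (fun k => h k) k := by
  induction k using Nat.strong_induction_on with
  | _ k ih =>
    rcases eq_or_ne k 0 with rfl | hk
    · simp [meanDigit_zero, digitVal]
    have hbit : DependsOn (fun b : ℕ → Bool => digitVal b k) (({k} : Finset ℕ) : Set ℕ) :=
      fun b b' hbb' => by simp [digitVal, hbb' k (by simp)]
    have hpast : DependsOn (fun b => 1 - spread (digitVal (goldenDigit b)) k)
        (chainTo (k / 2) : Set ℕ) := fun b b' hbb' => by
      simp only [spread, dependsOn_digitVal_goldenDigit (k / 2) hbb']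
    have hdisj : Disjoint {k} (chainTo (k / 2)) := by
      simp only [Finset.disjoint_singleton_left, chainTo, Finset.mem_filter, Finset.mem_Icc]
      omega
    have hmean : ∫ b, (1 - spread (digitVal (goldenDigit b)) k) ∂bitMeasure h =
        1 - spread (meanDigit fun k => h k) k := by
      unfold spread
      split_ifs with heven
      · rw [integral_sub (integrable_const _)
          ((memLp_digitVal_goldenDigit h _ 1).integrable le_rfl), ih _ (by omega)]
        simp
      · simp
    simp_rw [digitVal_goldenDigit_eq _ hk]
    rw [meanDigit_eq _ hk, ← hmean, ← integral_digitVal h k]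
    exact (indepFun_infinitePi_of_dependsOn _ hbit hpast hdisj).integral_fun_mul_eq_mul_integral
      (measurable_of_dependsOn hbit).aestronglyMeasurable
      (measurable_of_dependsOn hpast).aestronglyMeasurable

lemma card_ordCompl_eq_le (n j : ℕ) :
    ({k ∈ Finset.Icc 1 n | ordCompl[2] j = ordCompl[2] k}).card ≤ Nat.log 2 n + 1 := by
  have hsubset : {k ∈ Finset.Icc 1 n | ordCompl[2] j = ordCompl[2] k} ⊆
      (Finset.range (Nat.log 2 n + 1)).image fun v => 2 ^ v * ordCompl[2] j := by
    intro k hk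
    rw [Finset.mem_filter, Finset.mem_Icc] at hk
    refine Finset.mem_image.2 ⟨k.factorization 2, ?_, ?_⟩
    · exact Finset.mem_range_succ_iff.2 <|
        Nat.le_log_of_pow_le one_lt_two ((Nat.ordProj_le 2 (by omega)).trans hk.1.2)
    · rw [hk.2, Nat.ordProj_mul_ordCompl_eq_self]
  exact (Finset.card_le_card hsubset).trans (Finset.card_image_le.trans (by simp))

lemma covariance_weighted_digitVal_le (h : ℕ → unitInterval) {w : ℕ → ℝ} {W : ℝ}
    (hw : ∀ k, |w k| ≤ W) (j k : ℕ) :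
    cov[fun b => w j * digitVal (goldenDigit b) j, fun b => w k * digitVal (goldenDigit b) k;
      bitMeasure h] ≤ if ordCompl[2] j = ordCompl[2] k then W ^ 2 else 0 := by
  rw [covariance_const_mul_left, covariance_const_mul_right]
  split_ifs with hjk
  · have hW : 0 ≤ W := (abs_nonneg _).trans (hw j)
    have hcov := abs_covariance_le_of_mem_Icc (μ := bitMeasure h)
      (measurable_digitVal_goldenDigit j).aemeasurable
      (measurable_digitVal_goldenDigit k).aemeasurable
      (fun b => digitVal_mem_Icc (goldenDigit b) j) (fun b => digitVal_mem_Icc (goldenDigit b) k)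
    refine (le_abs_self _).trans ?_
    rw [abs_mul, abs_mul, ← mul_assoc]
    calc _ ≤ W * W * ((1 - 0) * (1 - 0)) := by
          gcongr
          · exact hw j
          · exact hw k
      _ = W ^ 2 := by ring
  · rw [(indepFun_digitVal_goldenDigit h hjk).covariance_eq_zero
      (memLp_digitVal_goldenDigit h j 2) (memLp_digitVal_goldenDigit h k 2), mul_zero, mul_zero]

lemma variance_sum_weighted_digitVal_le (h : ℕ → unitInterval) {w : ℕ → ℝ} {W : ℝ}
    (hw : ∀ k, |w k| ≤ W) (n : ℕ) :
    Var[fun b => ∑ k ∈ Finset.Icc 1 n, w k * digitVal (goldenDigit b) k; bitMeasure h] ≤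
      W ^ 2 * (n * (Nat.log 2 n + 1)) := by
  rw [variance_fun_sum' fun k _ => (memLp_digitVal_goldenDigit h k 2).const_mul _]
  have hrow (j : ℕ) : ∑ k ∈ Finset.Icc 1 n,
      cov[fun b => w j * digitVal (goldenDigit b) j, fun b => w k * digitVal (goldenDigit b) k;
        bitMeasure h] ≤ W ^ 2 * (Nat.log 2 n + 1) := by
    refine (Finset.sum_le_sum fun k _ => covariance_weighted_digitVal_le h hw j k).trans ?_
    rw [← Finset.sum_filter, Finset.sum_const, nsmul_eq_mul, mul_comm]
    gcongr
    exact_mod_cast card_ordCompl_eq_le n j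
  refine (Finset.sum_le_sum fun j _ => hrow j).trans (le_of_eq ?_)
  rw [Finset.sum_const, nsmul_eq_mul, Nat.card_Icc, Nat.add_sub_cancel]
  ring

lemma memLp_surprisal (h : ℕ → unitInterval) (g : ℕ → ℝ) (n : ℕ) (q : ℝ≥0∞) :
    MemLp (fun b => surprisal g (digitVal (goldenDigit b)) n) q (bitMeasure h) := by
  have hsum : MemLp (fun b => ∑ k ∈ Finset.Icc 1 n,
      surprisalWeight g n k * digitVal (goldenDigit b) k) q (bitMeasure h) :=
    memLp_finsetSum _ fun k _ => (memLp_digitVal_goldenDigit h k q).const_mul _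
  simp_rw [surprisal_eq_sum_weight_mul]
  exact (memLp_const (∑ k ∈ Finset.Icc 1 n, -Real.log (1 - g k))).add hsum

lemma integral_surprisal (h : ℕ → unitInterval) (g : ℕ → ℝ) (n : ℕ) :
    ∫ b, surprisal g (digitVal (goldenDigit b)) n ∂bitMeasure h =
      surprisal g (meanDigit fun k => h k) n := by
  have hint (k : ℕ) : Integrable
      (fun b => surprisalWeight g n k * digitVal (goldenDigit b) k) (bitMeasure h) :=
    ((memLp_digitVal_goldenDigit h k 1).integrable le_rfl).const_mul _
  have hsum := integrable_finsetSum (Finset.Icc 1 n) fun k _ => hint k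
  simp_rw [surprisal_eq_sum_weight_mul]
  rw [integral_add (integrable_const _) hsum, integral_finsetSum _ fun k _ => hint k]
  simp [integral_const_mul, integral_digitVal_goldenDigit]

lemma variance_surprisal_le (h : ℕ → unitInterval) {g : ℕ → ℝ} {W : ℝ}
    (hW : ∀ k, |Real.log (g k)| ≤ W) (hW' : ∀ k, |Real.log (1 - g k)| ≤ W) (n : ℕ) :
    Var[fun b => surprisal g (digitVal (goldenDigit b)) n; bitMeasure h] ≤
      (3 * W) ^ 2 * (n * (Nat.log 2 n + 1)) := by
  simp_rw [surprisal_eq_sum_weight_mul]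
  rw [variance_const_add (Finset.aestronglyMeasurable_fun_sum _ fun k _ =>
    ((measurable_digitVal_goldenDigit k).const_mul _).aestronglyMeasurable)]
  exact variance_sum_weighted_digitVal_le h (abs_surprisalWeight_le hW hW' n) n

lemma crossEntropy_sub_sq_le_binEntropy {t q : ℝ} (ht : t ∈ Set.Ioo 0 1) (hq : q ∈ Set.Ioo 0 1) :
    -(t * Real.log q) - (1 - t) * Real.log (1 - q) - (t - q) ^ 2 / (q * (1 - q)) ≤
      Real.binEntropy t := by
  have hq0 := hq.1
  have hq1 : 0 < 1 - q := sub_pos.2 hq.2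
  have ht1 : 0 < 1 - t := sub_pos.2 ht.2
  have hone : t * (Real.log t - Real.log q) ≤ t * (t / q - 1) := by
    rw [← Real.log_div ht.1.ne' hq0.ne']
    exact mul_le_mul_of_nonneg_left (Real.log_le_sub_one_of_pos (div_pos ht.1 hq0)) ht.1.le
  have hzero : (1 - t) * (Real.log (1 - t) - Real.log (1 - q)) ≤
      (1 - t) * ((1 - t) / (1 - q) - 1) := by
    rw [← Real.log_div ht1.ne' hq1.ne']
    exact mul_le_mul_of_nonneg_left (Real.log_le_sub_one_of_pos (div_pos ht1 hq1)) ht1.le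
  have hsq : t * (t / q - 1) + (1 - t) * ((1 - t) / (1 - q) - 1) =
      (t - q) ^ 2 / (q * (1 - q)) := by
    field_simp
    ring
  rw [Real.binEntropy, Real.log_inv, Real.log_inv]
  linarith

lemma surprisal_meanDigit (h : ℕ → ℝ) (n : ℕ) :
    surprisal h (meanDigit h) n =
      ∑ k ∈ Finset.Icc 1 n, (1 - spread (meanDigit h) k) * Real.binEntropy (h k) := by
  refine Finset.sum_congr rfl fun k hk => ?_
  rw [meanDigit_eq h (by have := Finset.mem_Icc.1 hk; omega), Real.binEntropy, Real.log_inv,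
    Real.log_inv]
  ring

lemma mem_Ioo_of_cube_eq {p : ℝ} (hp : p ^ 3 = (1 - p) ^ 2) : p ∈ Set.Ioo (1 / 2) 1 := by
  have hp0 : 0 < p := by
    by_contra! h
    nlinarith [mul_nonneg_of_nonpos_of_nonpos h h]
  constructor
  · by_contra! h
    nlinarith [mul_pos hp0 hp0]
  · by_contra! h
    nlinarith [mul_pos hp0 hp0, mul_nonneg (mul_pos hp0 hp0).le (sub_nonneg.2 h)]

lemma log_one_sub_of_cube_eq {p : ℝ} (hp : p ^ 3 = (1 - p) ^ 2) :
    Real.log (1 - p) = 3 / 2 * Real.log p := by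
  have hlog := congrArg Real.log hp
  rw [Real.log_pow, Real.log_pow] at hlog
  push_cast at hlog
  linarith

lemma surprisal_meanDigit_ge {p : ℝ} (hp : p ^ 3 = (1 - p) ^ 2) {h : ℕ → ℝ}
    (hh : ∀ k, h k ∈ Set.Ioo (0 : ℝ) 1) (n : ℕ) :
    n * -Real.log p + -Real.log p / 2 * (∑ k ∈ Finset.Icc 1 n, meanDigit h k -
        2 * ∑ k ∈ Finset.Icc 1 (n / 2), meanDigit h k) -
      (∑ k ∈ Finset.Icc 1 n, (h k - (1 - p)) ^ 2) / ((1 - p) * p) ≤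
      surprisal h (meanDigit h) n := by
  obtain ⟨hp0, hp1⟩ := mem_Ioo_of_cube_eq hp
  have hpq : 0 < (1 - p) * p := mul_pos (by linarith) (by linarith)
  have hterm (k : ℕ) (hk : k ∈ Finset.Icc 1 n) :
      -Real.log p + -Real.log p / 2 * meanDigit h k + Real.log p * spread (meanDigit h) k -
        (h k - (1 - p)) ^ 2 / ((1 - p) * p) ≤
      (1 - spread (meanDigit h) k) * Real.binEntropy (h k) := by
    have hentropy :=
      crossEntropy_sub_sq_le_binEntropy (hh k) (q := 1 - p) ⟨by linarith, by linarith⟩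
    rw [sub_sub_cancel, log_one_sub_of_cube_eq hp] at hentropy
    obtain ⟨hs0, hs1⟩ :=
      spread_mem_Icc (meanDigit_mem_Icc fun k => Set.Ioo_subset_Icc_self (hh k)) k
    rw [meanDigit_eq h (by have := Finset.mem_Icc.1 hk; omega)]
    refine le_trans ?_ (mul_le_mul_of_nonneg_left hentropy (sub_nonneg.2 hs1))
    have hcost : 0 ≤ spread (meanDigit h) k * ((h k - (1 - p)) ^ 2 / ((1 - p) * p)) := by
      positivity
    linarith
  rw [surprisal_meanDigit]
  refine le_trans (le_of_eq ?_) (Finset.sum_le_sum hterm)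
  rw [Finset.sum_sub_distrib, Finset.sum_add_distrib, Finset.sum_add_distrib, Finset.sum_const,
    ← Finset.mul_sum, ← Finset.mul_sum, sum_Icc_spread, ← Finset.sum_div]
  simp only [Nat.card_Icc, Nat.add_sub_cancel, nsmul_eq_mul]
  ring

lemma log_two_pow_add {l i : ℕ} (hi : i < 2 ^ l) : Nat.log 2 (2 ^ l + i) = l := by
  rw [Nat.log_eq_iff (Or.inr ⟨one_lt_two, by positivity⟩), pow_succ]
  omega

lemma log_two_two_mul {m : ℕ} (hm : m ≠ 0) : Nat.log 2 (2 * m) = Nat.log 2 m + 1 := by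
  rw [mul_comm, Nat.log_mul_base one_lt_two hm]

lemma log_two_two_mul_add_one {m : ℕ} (hm : m ≠ 0) : Nat.log 2 (2 * m + 1) = Nat.log 2 m + 1 := by
  rw [← log_two_two_mul hm, ← Nat.log_div_mul_self, show (2 * m + 1) / 2 * 2 = 2 * m by omega]

lemma abs_sum_Icc_le_of_dyadic_blocks {d : ℕ → ℝ}
    (hd : ∀ l, ∀ j ≤ 2 ^ l, |∑ i ∈ Finset.range j, d (2 ^ l + i)| ≤ 1) (n : ℕ) :
    |∑ k ∈ Finset.Icc 1 n, d k| ≤ Nat.log 2 n + 1 := by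
  have hblock (l m : ℕ) (hm : m ≤ 2 ^ (l + 1)) : |∑ k ∈ Finset.Ico (2 ^ l) m, d k| ≤ 1 := by
    rw [Finset.sum_Ico_eq_sum_range]
    exact hd l _ (by rw [pow_succ] at hm; omega)
  have hfull (l : ℕ) : |∑ k ∈ Finset.Ico 1 (2 ^ l), d k| ≤ l := by
    induction l with
    | zero => simp
    | succ l ih =>
      rw [← Finset.sum_Ico_consecutive _ (Nat.one_le_two_pow (n := l))
        (Nat.pow_le_pow_right two_pos l.le_succ), Nat.cast_succ]
      exact (abs_add_le _ _).trans (add_le_add ih (hblock l _ le_rfl))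
  rcases eq_or_ne n 0 with rfl | hn
  · simp
  have hIcc : Finset.Icc 1 n = Finset.Ico 1 (n + 1) := by
    ext k
    simp only [Finset.mem_Icc, Finset.mem_Ico, Nat.lt_succ_iff]
  rw [hIcc, ← Finset.sum_Ico_consecutive _ (Nat.one_le_two_pow (n := Nat.log 2 n))
    ((Nat.pow_log_le_self 2 hn).trans n.le_succ)]
  exact (abs_add_le _ _).trans
    (add_le_add (hfull _) (hblock _ _ (Nat.lt_pow_succ_log_self one_lt_two n)))

lemma sum_Icc_comp_log_le {f : ℕ → ℝ} (hf0 : ∀ l, 0 ≤ f l) (hf : ∀ l, f l ≤ 3 / 2 * f (l + 1))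
    (n : ℕ) : ∑ k ∈ Finset.Icc 1 n, f (Nat.log 2 k) ≤ 4 * n * f (Nat.log 2 n) := by
  have hblock (l : ℕ) :
      ∑ k ∈ Finset.Ico (2 ^ l) (2 ^ (l + 1)), f (Nat.log 2 k) = 2 ^ l * f l := by
    rw [Finset.sum_congr rfl fun k hk => congrArg f <| (Nat.log_eq_iff (Or.inr ⟨one_lt_two,
      (Nat.two_pow_pos l).trans_le (Finset.mem_Ico.1 hk).1 |>.ne'⟩)).2 (Finset.mem_Ico.1 hk),
      Finset.sum_const, Nat.card_Ico, pow_succ, show 2 ^ l * 2 - 2 ^ l = 2 ^ l by omega,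
      nsmul_eq_mul, Nat.cast_pow, Nat.cast_two]
  have hfull (l : ℕ) :
      ∑ k ∈ Finset.Ico 1 (2 ^ (l + 1)), f (Nat.log 2 k) ≤ 4 * 2 ^ l * f l := by
    induction l with
    | zero =>
      have hone := hblock 0
      rw [pow_zero] at hone ⊢
      linarith [hf0 0]
    | succ l ih =>
      rw [← Finset.sum_Ico_consecutive _ (Nat.one_le_two_pow (n := l + 1))
        (Nat.pow_le_pow_right two_pos (l + 1).le_succ), hblock]
      have hstep := mul_le_mul_of_nonneg_left (hf l) (show (0 : ℝ) ≤ 4 * 2 ^ l by positivity)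
      have hpow : (2 : ℝ) ^ (l + 1) = 2 ^ l * 2 := pow_succ 2 l
      rw [hpow]
      linarith
  rcases eq_or_ne n 0 with rfl | hn
  · simp
  calc ∑ k ∈ Finset.Icc 1 n, f (Nat.log 2 k)
      ≤ ∑ k ∈ Finset.Ico 1 (2 ^ (Nat.log 2 n + 1)), f (Nat.log 2 k) := by
        refine Finset.sum_le_sum_of_subset_of_nonneg (fun k hk => ?_) fun _ _ _ => hf0 _
        rw [Finset.mem_Icc] at hk
        exact Finset.mem_Ico.2
          ⟨hk.1, hk.2.trans_lt (Nat.lt_pow_succ_log_self one_lt_two n)⟩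
    _ ≤ 4 * 2 ^ Nat.log 2 n * f (Nat.log 2 n) := hfull _
    _ ≤ 4 * n * f (Nat.log 2 n) := by
        gcongr
        · exact hf0 _
        · exact_mod_cast Nat.pow_log_le_self 2 hn

lemma sum_Icc_comp_log_sub_ge {ρ : ℕ → ℝ} (hρ : ∀ l, ρ l ∈ Set.Icc (0 : ℝ) 1) {g : ℝ} (hg : 0 ≤ g)
    {n : ℕ} (hinc : ∀ l ≤ Nat.log 2 n, g ≤ ρ (l + 1) - ρ l) :
    (n : ℝ) * g - g - 1 ≤ ∑ k ∈ Finset.Icc 1 n, ρ (Nat.log 2 k) -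
      2 * ∑ k ∈ Finset.Icc 1 (n / 2), ρ (Nat.log 2 k) := by
  have hodd (m : ℕ) (hm : m ≤ n) : 2 * (m : ℝ) * g ≤
      ∑ k ∈ Finset.Icc 1 (2 * m + 1), ρ (Nat.log 2 k) -
        2 * ∑ k ∈ Finset.Icc 1 m, ρ (Nat.log 2 k) := by
    induction m with
    | zero => simpa using (hρ 0).1
    | succ m ih =>
      rw [mul_add_one 2 m, Finset.sum_Icc_succ_top (by omega), Finset.sum_Icc_succ_top (by omega),
        Finset.sum_Icc_succ_top (b := m) (by omega), ← mul_add_one 2 m,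
        log_two_two_mul_add_one (m := m + 1) (by omega), log_two_two_mul (m := m + 1) (by omega)]
      have hlast := hinc (Nat.log 2 (m + 1)) (Nat.log_mono_right hm)
      push_cast
      linarith [ih (by omega)]
  have hhalf := hodd (n / 2) (by omega)
  rcases Nat.even_or_odd' n with ⟨m, rfl | rfl⟩
  · rw [Nat.mul_div_cancel_left _ two_pos] at hhalf ⊢
    rw [Finset.sum_Icc_succ_top (by omega)] at hhalf
    push_cast
    linarith [(hρ (Nat.log 2 (2 * m + 1))).2]
  · rw [show (2 * m + 1) / 2 = m by omega] at hhalf ⊢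
    push_cast
    linarith

section DyadicBlocks

variable {H ρ : ℕ → ℝ}

lemma meanDigit_comp_log_two_mul {m : ℕ} (hm : m ≠ 0) :
    meanDigit (fun k => H (Nat.log 2 k)) (2 * m) =
      H (Nat.log 2 m + 1) * (1 - meanDigit (fun k => H (Nat.log 2 k)) m) := by
  rw [meanDigit_eq _ (by omega), spread_two_mul, log_two_two_mul hm]

lemma meanDigit_comp_log_two_mul_add_one {m : ℕ} (hm : m ≠ 0) :
    meanDigit (fun k => H (Nat.log 2 k)) (2 * m + 1) = H (Nat.log 2 m + 1) := by
  rw [meanDigit_eq _ (by omega), spread_two_mul_add_one, log_two_two_mul_add_one hm, sub_zero,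
    mul_one]

lemma sum_block_meanDigit_two_mul (hstep : ∀ l, ρ (l + 1) = H (l + 1) * (1 - ρ l / 2)) (l : ℕ)
    {j : ℕ} (hj : j ≤ 2 ^ l) :
    ∑ i ∈ Finset.range (2 * j),
        (meanDigit (fun k => H (Nat.log 2 k)) (2 ^ (l + 1) + i) - ρ (l + 1)) =
      -H (l + 1) * ∑ i ∈ Finset.range j,
        (meanDigit (fun k => H (Nat.log 2 k)) (2 ^ l + i) - ρ l) := by
  induction j with
  | zero => simp
  | succ j ih =>
    have hne : 2 ^ l + j ≠ 0 := by positivity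
    rw [mul_add_one, Finset.sum_range_succ, Finset.sum_range_succ, ih (by omega),
      Finset.sum_range_succ, show 2 ^ (l + 1) + 2 * j = 2 * (2 ^ l + j) by ring,
      show 2 ^ (l + 1) + (2 * j + 1) = 2 * (2 ^ l + j) + 1 by ring,
      meanDigit_comp_log_two_mul hne, meanDigit_comp_log_two_mul_add_one hne,
      log_two_pow_add (by omega), hstep]
    ring

lemma abs_sum_block_meanDigit_sub_le (hH : ∀ l, H l ∈ Set.Icc (0 : ℝ) (1 / 2))
    (hρ : ∀ l, ρ l ∈ Set.Icc (0 : ℝ) (1 / 2)) (hstep : ∀ l, ρ (l + 1) = H (l + 1) * (1 - ρ l / 2))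
    (l : ℕ) : ∀ j ≤ 2 ^ l,
      |∑ i ∈ Finset.range j, (meanDigit (fun k => H (Nat.log 2 k)) (2 ^ l + i) - ρ l)| ≤ 1 := by
  have hr (k : ℕ) : meanDigit (fun k => H (Nat.log 2 k)) k ∈ Set.Icc (0 : ℝ) 1 :=
    meanDigit_mem_Icc (fun k => ⟨(hH _).1, (hH _).2.trans (by norm_num)⟩) k
  induction l with
  | zero =>
    intro j hj
    rcases (show j = 0 ∨ j = 1 by simpa [Nat.le_one_iff_eq_zero_or_eq_one] using hj) with rfl | rfl
    · simp
    · rw [Finset.sum_range_one, abs_le]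
      constructor <;> linarith [(hr (2 ^ 0 + 0)).1, (hr (2 ^ 0 + 0)).2, (hρ 0).1, (hρ 0).2]
  | succ l ih =>
    have heven (m : ℕ) (hm : m ≤ 2 ^ l) : |∑ i ∈ Finset.range (2 * m),
        (meanDigit (fun k => H (Nat.log 2 k)) (2 ^ (l + 1) + i) - ρ (l + 1))| ≤ 1 / 2 := by
      rw [sum_block_meanDigit_two_mul hstep l hm, abs_mul, abs_neg, abs_of_nonneg (hH _).1]
      exact (mul_le_mul (hH _).2 (ih m hm) (abs_nonneg _) (by norm_num)).trans_eq (mul_one _)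
    intro j hj
    rcases Nat.even_or_odd' j with ⟨m, rfl | rfl⟩
    · exact (heven m (by rw [pow_succ] at hj; omega)).trans (by norm_num)
    · have hm : m < 2 ^ l := by rw [pow_succ] at hj; omega
      have hlast : |meanDigit (fun k => H (Nat.log 2 k)) (2 ^ (l + 1) + 2 * m) - ρ (l + 1)| ≤
          1 / 2 := by
        rw [show 2 ^ (l + 1) + 2 * m = 2 * (2 ^ l + m) by ring,
          meanDigit_comp_log_two_mul (by positivity), log_two_pow_add hm, abs_le]
        have hmean := hr (2 ^ l + m)
        have hle := mul_le_mul (hH (l + 1)).2 (sub_le_self 1 hmean.1) (sub_nonneg.2 hmean.2)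
          (by norm_num)
        have hnonneg := mul_nonneg (hH (l + 1)).1 (sub_nonneg.2 hmean.2)
        constructor <;> linarith [(hρ (l + 1)).1, (hρ (l + 1)).2]
      rw [Finset.sum_range_succ]
      exact (abs_add_le _ _).trans (by linarith [heven m hm.le])

lemma abs_sum_meanDigit_sub_le (hH : ∀ l, H l ∈ Set.Icc (0 : ℝ) (1 / 2))
    (hρ : ∀ l, ρ l ∈ Set.Icc (0 : ℝ) (1 / 2)) (hstep : ∀ l, ρ (l + 1) = H (l + 1) * (1 - ρ l / 2))
    (n : ℕ) :
    |∑ k ∈ Finset.Icc 1 n, meanDigit (fun k => H (Nat.log 2 k)) k -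
      ∑ k ∈ Finset.Icc 1 n, ρ (Nat.log 2 k)| ≤ Nat.log 2 n + 1 := by
  rw [← Finset.sum_sub_distrib]
  refine abs_sum_Icc_le_of_dyadic_blocks (fun l j hj => ?_) n
  rw [Finset.sum_congr rfl fun i hi => congrArg _ <| congrArg ρ <|
    log_two_pow_add ((Finset.mem_range.1 hi).trans_le hj)]
  exact abs_sum_block_meanDigit_sub_le hH hρ hstep l j hj

end DyadicBlocks

/-- The solution `R` of `R = q * (1 - R / 2)`: the mean of the digits over a dyadic block that
reproduces itself in the next block when all biases are equal to `q`. -/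
noncomputable def stationaryMean (q : ℝ) : ℝ := 2 * q / (2 + q)

/-- The prescribed mean of the digits over the dyadic block `[2 ^ x, 2 ^ (x + 1))`, which increases
slowly to the stationary one. The argument is real so that the block before the first one also makes
sense. -/
noncomputable def blockMean (q η x : ℝ) : ℝ := stationaryMean q - η / (x + 6)

/-- The bias on the `l`-th dyadic block that turns the mean `blockMean q η (l - 1)` of the preceding
block into `blockMean q η l`. -/
noncomputable def blockBias (q η : ℝ) (l : ℕ) : ℝ :=
  blockMean q η l / (1 - blockMean q η (l - 1) / 2)

section BlockBias

variable {q η : ℝ}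

lemma stationaryMean_pos (hq : 0 < q) : 0 < stationaryMean q :=
  div_pos (by linarith) (by linarith)

lemma stationaryMean_eq (hq : 0 < q) : stationaryMean q = q * (1 - stationaryMean q / 2) := by
  rw [stationaryMean]
  field_simp
  ring

lemma stationaryMean_le (hq : 0 < q) : stationaryMean q ≤ q := by
  have hpos := mul_pos hq (stationaryMean_pos hq)
  linarith [stationaryMean_eq hq]

lemma blockMean_mem_Icc (hη : η ∈ Set.Icc 0 (stationaryMean q)) {x : ℝ} (hx : -1 ≤ x) :
    blockMean q η x ∈ Set.Icc (stationaryMean q / 2) (stationaryMean q) := by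
  have hnonneg : 0 ≤ η / (x + 6) := div_nonneg hη.1 (by linarith)
  have hle : η / (x + 6) ≤ stationaryMean q / 2 :=
    div_le_div₀ (hη.1.trans hη.2) hη.2 two_pos (by linarith)
  constructor <;> rw [blockMean] <;> linarith

lemma blockMean_mem_Icc_half (hq : q ∈ Set.Ioo 0 (1 / 2)) (hη : η ∈ Set.Icc 0 (stationaryMean q))
    {x : ℝ} (hx : -1 ≤ x) : blockMean q η x ∈ Set.Icc 0 (1 / 2) := by
  have hmean := blockMean_mem_Icc hη hx
  constructor <;> linarith [hmean.1, hmean.2, stationaryMean_pos hq.1, stationaryMean_le hq.1, hq.2]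

lemma blockMean_add_one_sub {x : ℝ} (hx : 0 ≤ x) :
    blockMean q η (x + 1) - blockMean q η x = η / ((x + 6) * (x + 7)) := by
  rw [blockMean, blockMean]
  field_simp
  ring

lemma neg_one_le_natCast_sub_one (l : ℕ) : (-1 : ℝ) ≤ l - 1 := by
  linarith [l.cast_nonneg (α := ℝ)]

lemma sub_blockBias (hq : q ∈ Set.Ioo 0 (1 / 2)) (hη : η ∈ Set.Icc 0 (stationaryMean q)) (l : ℕ) :
    q - blockBias q η l =
      (q / 2 * (η / (l + 5)) + η / (l + 6)) / (1 - blockMean q η (l - 1) / 2) := by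
  have hne : 1 - blockMean q η (l - 1) / 2 ≠ 0 := by
    linarith [(blockMean_mem_Icc_half hq hη (neg_one_le_natCast_sub_one l)).2]
  rw [blockBias, eq_div_iff hne, sub_mul, div_mul_cancel₀ _ hne, blockMean, blockMean,
    show (l : ℝ) - 1 + 6 = l + 5 by ring]
  linarith [stationaryMean_eq hq.1]

lemma sub_blockBias_mem_Icc (hq : q ∈ Set.Ioo 0 (1 / 2)) (hη : η ∈ Set.Icc 0 (stationaryMean q))
    (l : ℕ) : q - blockBias q η l ∈ Set.Icc 0 (2 * (η / (l + 5))) := by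
  have hden := (blockMean_mem_Icc_half hq hη (neg_one_le_natCast_sub_one l)).2
  have hη0 := hη.1
  have hq0 := hq.1
  have hstep : 0 ≤ η / (l + 5 : ℝ) := by positivity
  have hanti : η / (l + 6 : ℝ) ≤ η / (l + 5) := by gcongr; norm_num
  have hq2 : q * (η / (l + 5)) ≤ 1 / 2 * (η / (l + 5)) := mul_le_mul_of_nonneg_right hq.2.le hstep
  have hscale : 3 / 4 * (η / (l + 5 : ℝ)) ≤
      (1 - blockMean q η (l - 1) / 2) * (η / (l + 5)) :=
    mul_le_mul_of_nonneg_right (by linarith) hstep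
  rw [sub_blockBias hq hη]
  constructor
  · exact div_nonneg (by positivity) (by linarith)
  · rw [div_le_iff₀ (by linarith)]
    linarith

lemma blockBias_mem_Icc (hq : q ∈ Set.Ioo 0 (1 / 2)) (hη : η ∈ Set.Icc 0 (stationaryMean q))
    (l : ℕ) : blockBias q η l ∈ Set.Icc (stationaryMean q / 2) q := by
  refine ⟨?_, sub_nonneg.1 (sub_blockBias_mem_Icc hq hη l).1⟩
  have hden := blockMean_mem_Icc_half hq hη (neg_one_le_natCast_sub_one l)
  have hmean := (blockMean_mem_Icc hη (neg_one_lt_zero.le.trans l.cast_nonneg)).1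
  exact hmean.trans <| le_div_self ((half_pos (stationaryMean_pos hq.1)).le.trans hmean)
    (by linarith [hden.2]) (by linarith [hden.1])

lemma blockMean_succ (hq : q ∈ Set.Ioo 0 (1 / 2)) (hη : η ∈ Set.Icc 0 (stationaryMean q)) (l : ℕ) :
    blockMean q η ↑(l + 1) = blockBias q η (l + 1) * (1 - blockMean q η l / 2) := by
  have hmean := blockMean_mem_Icc_half hq hη (neg_one_lt_zero.le.trans l.cast_nonneg)
  rw [blockBias, Nat.cast_succ, add_sub_cancel_right, div_mul_cancel₀ _ (by linarith [hmean.2])]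

lemma sum_sq_blockBias_sub_le (hq : q ∈ Set.Ioo 0 (1 / 2)) (hη : η ∈ Set.Icc 0 (stationaryMean q))
    (n : ℕ) : ∑ k ∈ Finset.Icc 1 n, (blockBias q η (Nat.log 2 k) - q) ^ 2 ≤
      32 * η ^ 2 * (n / ((Nat.log 2 n : ℝ) + 7) ^ 2) := by
  have hterm (l : ℕ) : (blockBias q η l - q) ^ 2 ≤ 8 * η ^ 2 * (1 / ((l : ℝ) + 7) ^ 2) := by
    have hsub := sub_blockBias_mem_Icc hq hη l
    calc (blockBias q η l - q) ^ 2 = (q - blockBias q η l) ^ 2 := by ring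
      _ ≤ (2 * (η / (l + 5))) ^ 2 := pow_le_pow_left₀ hsub.1 hsub.2 2
      _ = 4 * η ^ 2 * (1 / ((l : ℝ) + 5) ^ 2) := by rw [mul_pow, div_pow]; ring
      _ ≤ 4 * η ^ 2 * (2 / ((l : ℝ) + 7) ^ 2) := by
          refine mul_le_mul_of_nonneg_left ?_ (by positivity)
          rw [div_le_div_iff₀ (by positivity) (by positivity)]
          nlinarith [l.cast_nonneg (α := ℝ)]
      _ = 8 * η ^ 2 * (1 / ((l : ℝ) + 7) ^ 2) := by ring
  have hsum := sum_Icc_comp_log_le (f := fun l => 1 / ((l : ℝ) + 7) ^ 2)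
    (fun l => by positivity) (fun l => by
      push_cast
      rw [mul_one_div, div_le_div_iff₀ (by positivity) (by positivity)]
      nlinarith [l.cast_nonneg (α := ℝ)]) n
  refine (Finset.sum_le_sum fun k _ => hterm (Nat.log 2 k)).trans ?_
  rw [← Finset.mul_sum]
  refine (mul_le_mul_of_nonneg_left hsum (by positivity)).trans_eq ?_
  ring

lemma sum_meanDigit_blockBias_sub_ge (hq : q ∈ Set.Ioo 0 (1 / 2))
    (hη : η ∈ Set.Icc 0 (stationaryMean q)) (n : ℕ) :
    η * (n / ((Nat.log 2 n : ℝ) + 7) ^ 2) - 5 * ((Nat.log 2 n : ℝ) + 1) ≤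
      ∑ k ∈ Finset.Icc 1 n, meanDigit (fun k => blockBias q η (Nat.log 2 k)) k -
        2 * ∑ k ∈ Finset.Icc 1 (n / 2), meanDigit (fun k => blockBias q η (Nat.log 2 k)) k := by
  have hR := stationaryMean_le hq.1
  have hη0 := hη.1
  have hη1 : η ≤ 1 := by linarith [hη.2, hq.2]
  have hmean (l : ℕ) : blockMean q η l ∈ Set.Icc (0 : ℝ) (1 / 2) :=
    blockMean_mem_Icc_half hq hη (neg_one_lt_zero.le.trans l.cast_nonneg)
  have herror := abs_sum_meanDigit_sub_le (fun l => ⟨(half_pos (stationaryMean_pos hq.1)).le.trans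
    (blockBias_mem_Icc hq hη l).1, (blockBias_mem_Icc hq hη l).2.trans hq.2.le⟩) hmean
    (blockMean_succ hq hη)
  have herror_half := (abs_le.1 (herror (n / 2))).2
  have hlog : (Nat.log 2 (n / 2) : ℝ) ≤ Nat.log 2 n := by
    exact_mod_cast Nat.log_mono_right (Nat.div_le_self n 2)
  have hgrowth := sum_Icc_comp_log_sub_ge (ρ := fun l => blockMean q η l)
    (g := η / ((Nat.log 2 n : ℝ) + 7) ^ 2) (n := n)
    (fun l => Set.Icc_subset_Icc_right (by norm_num) (hmean l)) (by positivity) fun l hl => by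
      have hl : (l : ℝ) ≤ Nat.log 2 n := by exact_mod_cast hl
      rw [Nat.cast_succ, blockMean_add_one_sub l.cast_nonneg]
      refine div_le_div_of_nonneg_left hη0 (by positivity) ?_
      nlinarith [l.cast_nonneg (α := ℝ)]
  have hsmall : η / ((Nat.log 2 n : ℝ) + 7) ^ 2 ≤ 1 := by
    rw [div_le_one (by positivity)]
    nlinarith [(Nat.log 2 n).cast_nonneg (α := ℝ)]
  rw [mul_div_left_comm]
  linarith [(abs_le.1 (herror n)).1, (Nat.log 2 n).cast_nonneg (α := ℝ)]

lemma surprisal_blockBias_ge {p : ℝ} (hp : p ^ 3 = (1 - p) ^ 2)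
    (hη : η ∈ Set.Icc 0 (stationaryMean (1 - p)))
    (hηp : 128 * η ≤ -Real.log p * ((1 - p) * p)) (n : ℕ) :
    n * -Real.log p + -Real.log p * η / 4 * (n / ((Nat.log 2 n : ℝ) + 7) ^ 2) -
        3 * -Real.log p * ((Nat.log 2 n : ℝ) + 1) ≤
      surprisal (fun k => blockBias (1 - p) η (Nat.log 2 k))
        (meanDigit fun k => blockBias (1 - p) η (Nat.log 2 k)) n := by
  obtain ⟨hp0, hp1⟩ := mem_Ioo_of_cube_eq hp
  have hL : 0 < -Real.log p := neg_pos.2 (Real.log_neg (by linarith) hp1)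
  have hpq : 0 < (1 - p) * p := mul_pos (by linarith) (by linarith)
  have hq : 1 - p ∈ Set.Ioo 0 (1 / 2) := ⟨by linarith, by linarith⟩
  have hbias (l : ℕ) := blockBias_mem_Icc hq hη l
  have hgain := mul_le_mul_of_nonneg_left (sum_meanDigit_blockBias_sub_ge hq hη n) (half_pos hL).le
  have hcost : (∑ k ∈ Finset.Icc 1 n, (blockBias (1 - p) η (Nat.log 2 k) - (1 - p)) ^ 2) /
      ((1 - p) * p) ≤ -Real.log p * η / 4 * (n / ((Nat.log 2 n : ℝ) + 7) ^ 2) := by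
    rw [div_le_iff₀ hpq]
    refine (sum_sq_blockBias_sub_le hq hη n).trans ?_
    have := mul_le_mul_of_nonneg_right hηp
      (show 0 ≤ η / 4 * (n / ((Nat.log 2 n : ℝ) + 7) ^ 2) from mul_nonneg (by linarith [hη.1])
        (by positivity))
    linarith
  have hentropy := surprisal_meanDigit_ge hp (h := fun k => blockBias (1 - p) η (Nat.log 2 k))
    (fun k => ⟨(half_pos (stationaryMean_pos hq.1)).trans_le (hbias _).1,
      (hbias _).2.trans_lt (by linarith)⟩) n
  have hlog := mul_nonneg hL.le ((Nat.log 2 n).cast_nonneg (α := ℝ))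
  linarith

end BlockBias

lemma exists_bias {p : ℝ} (hp : p ^ 3 = (1 - p) ^ 2) :
    ∃ (h : ℕ → unitInterval) (κ W C : ℝ), 0 < κ ∧ (∀ k, (h k : ℝ) ∈ Set.Ioo 0 1) ∧
      (∀ k, |Real.log (h k)| ≤ W) ∧ (∀ k, |Real.log (1 - h k)| ≤ W) ∧
      ∀ n : ℕ, n * -Real.log p + κ * (n / ((Nat.log 2 n : ℝ) + 7) ^ 2) -
        C * ((Nat.log 2 n : ℝ) + 1) ≤
          surprisal (fun k => h k) (meanDigit fun k => h k) n := by
  obtain ⟨hp0, hp1⟩ := mem_Ioo_of_cube_eq hp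
  have hL : 0 < -Real.log p := neg_pos.2 (Real.log_neg (by linarith) hp1)
  have hpq : 0 < (1 - p) * p := mul_pos (by linarith) (by linarith)
  have hq : 1 - p ∈ Set.Ioo 0 (1 / 2) := ⟨by linarith, by linarith⟩
  have hR := stationaryMean_pos hq.1
  obtain ⟨η, hη0, hηR, hηp⟩ : ∃ η, 0 < η ∧ η ≤ stationaryMean (1 - p) ∧
      η ≤ -Real.log p * ((1 - p) * p) / 128 :=
    ⟨min _ _, lt_min hR (by positivity), min_le_left _ _, min_le_right _ _⟩
  have hbias (k : ℕ) := blockBias_mem_Icc hq ⟨hη0.le, hηR⟩ (Nat.log 2 k)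
  have hIoo (k : ℕ) : blockBias (1 - p) η (Nat.log 2 k) ∈ Set.Ioo 0 1 :=
    ⟨(half_pos hR).trans_le (hbias k).1, (hbias k).2.trans_lt (by linarith)⟩
  have habs_log {x : ℝ} (hx : stationaryMean (1 - p) / 2 ≤ x) (hx1 : x ≤ 1) :
      |Real.log x| ≤ -Real.log (stationaryMean (1 - p) / 2) := by
    rw [abs_of_nonpos (Real.log_nonpos ((half_pos hR).le.trans hx) hx1)]
    exact neg_le_neg (Real.log_le_log (half_pos hR) hx)
  refine ⟨fun k => ⟨_, Set.Ioo_subset_Icc_self (hIoo k)⟩, -Real.log p * η / 4,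
    -Real.log (stationaryMean (1 - p) / 2), 3 * -Real.log p, by positivity, hIoo,
    fun k => habs_log (hbias k).1 (hIoo k).2.le,
    fun k => habs_log ?_ (by linarith [(hIoo k).1]),
    surprisal_blockBias_ge hp ⟨hη0.le, hηR⟩ (by linarith)⟩
  linarith [(hbias k).2, stationaryMean_le hq.1]

lemma isBigO_natLog_add (c : ℝ) :
    (fun n : ℕ => (Nat.log 2 n : ℝ) + c) =O[atTop] fun n : ℕ => Real.log n := by
  refine Asymptotics.IsBigO.add ?_ ?_
  · refine Asymptotics.IsBigO.of_bound (1 / Real.log 2) ?_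
    filter_upwards [eventually_ge_atTop 1] with n hn
    rw [Real.norm_natCast, Real.norm_of_nonneg (Real.log_nonneg (by exact_mod_cast hn)),
      one_div_mul_eq_div]
    exact Real.natLog_le_logb n 2
  · exact (Asymptotics.isLittleO_const_left.2 (Or.inr (tendsto_norm_atTop_atTop.comp
      (Real.tendsto_log_atTop.comp tendsto_natCast_atTop_atTop)))).isBigO

lemma isLittleO_natLog_add_pow_rpow (c : ℝ) (k : ℕ) {ε : ℝ} (hε : 0 < ε) :
    (fun n : ℕ => ((Nat.log 2 n : ℝ) + c) ^ k) =o[atTop] fun n : ℕ => (n : ℝ) ^ ε := by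
  refine ((isBigO_natLog_add c).pow k).trans_isLittleO ?_
  exact ((isLittleO_log_rpow_rpow_atTop k hε).comp_tendsto
    tendsto_natCast_atTop_atTop).congr_left fun n => Real.rpow_natCast _ _

lemma summable_natLog_sq_add_pow_div_sq (c : ℝ) (k : ℕ) :
    Summable fun j : ℕ => ((Nat.log 2 (j ^ 2) : ℝ) + c) ^ k / ((j ^ 2 : ℕ) : ℝ) := by
  have hlog := (isLittleO_natLog_add_pow_rpow c k (show (0 : ℝ) < 1 / 4 by norm_num)).comp_tendsto
    (tendsto_pow_atTop two_ne_zero)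
  refine summable_of_isBigO_nat (Real.summable_nat_rpow.2 (show -(3 / 2) < (-1 : ℝ) by norm_num))
    ((hlog.isBigO.mul (Asymptotics.isBigO_refl (fun j : ℕ => ((j ^ 2 : ℕ) : ℝ)⁻¹) atTop)).congr'
      (Eventually.of_forall fun j => (div_eq_mul_inv _ _).symm) ?_)
  filter_upwards [eventually_gt_atTop 0] with j hj
  have hj : (0 : ℝ) < j := by exact_mod_cast hj
  simp only [Function.comp_apply, Nat.cast_pow]
  rw [← Real.rpow_natCast (j : ℝ) 2, ← Real.rpow_mul hj.le, ← Real.rpow_neg hj.le,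
    ← Real.rpow_add hj]
  norm_num

lemma ae_eventually_abs_sub_integral_lt {Ω : Type*} [MeasurableSpace Ω] {μ : Measure Ω}
    [IsFiniteMeasure μ] {S : ℕ → Ω → ℝ} (hS : ∀ j, MemLp (S j) 2 μ) {t : ℕ → ℝ} (ht : ∀ j, 0 < t j)
    (hsum : Summable fun j => Var[S j; μ] / t j ^ 2) :
    ∀ᵐ ω ∂μ, ∀ᶠ j in atTop, |S j ω - μ[S j]| < t j := by
  have hfinite : ∑' j, μ {ω | t j ≤ |S j ω - μ[S j]|} ≠ ∞ :=
    ne_top_of_le_ne_top hsum.tsum_ofReal_ne_top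
      (ENNReal.tsum_le_tsum fun j => meas_ge_le_variance_div_sq (hS j) (ht j))
  filter_upwards [ae_eventually_notMem hfinite] with ω hω
  filter_upwards [hω] with j hj
  exact not_le.1 hj

lemma eventually_natLog_add_one_le (C : ℝ) {κ : ℝ} (hκ : 0 < κ) :
    ∀ᶠ n : ℕ in atTop,
      C * ((Nat.log 2 n : ℝ) + 1) ≤ κ * (n / ((Nat.log 2 n : ℝ) + 7) ^ 2) := by
  have hsmall : (fun n : ℕ => C * (((Nat.log 2 n : ℝ) + 1) * ((Nat.log 2 n : ℝ) + 7) ^ 2)) =o[atTop]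
      fun n : ℕ => (n : ℝ) := by
    refine (((isBigO_natLog_add 1).mul ((isBigO_natLog_add 7).pow 2)).const_mul_left
      C).trans_isLittleO ?_
    refine ((Real.isLittleO_pow_log_id_atTop (n := 3)).comp_tendsto
      tendsto_natCast_atTop_atTop).congr_left fun n => ?_
    simp only [Function.comp_apply]
    ring
  filter_upwards [hsmall.bound hκ] with n hn
  rw [Real.norm_natCast, ← mul_assoc] at hn
  rw [← mul_div_assoc, le_div_iff₀ (by positivity)]
  exact (Real.le_norm_self _).trans hn

lemma summable_variance_surprisal_div_sq {h : ℕ → unitInterval} {W : ℝ}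
    (hW : ∀ k, |Real.log (h k)| ≤ W) (hW' : ∀ k, |Real.log (1 - h k)| ≤ W) (κ : ℝ) :
    Summable fun j : ℕ =>
      Var[fun b => surprisal (fun k => h k) (digitVal (goldenDigit b)) (j ^ 2); bitMeasure h] /
        (κ * (((j ^ 2 : ℕ) : ℝ) / ((Nat.log 2 (j ^ 2) : ℝ) + 7) ^ 2)) ^ 2 := by
  refine Summable.of_nonneg_of_le
    (fun j => div_nonneg (variance_nonneg _ _) (sq_nonneg _)) (fun j => ?_)
    ((summable_natLog_sq_add_pow_div_sq 7 5).mul_left ((3 * W) ^ 2 / κ ^ 2))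
  calc _ ≤ (3 * W) ^ 2 * (((j ^ 2 : ℕ) : ℝ) * (Nat.log 2 (j ^ 2) + 1)) /
        (κ * (((j ^ 2 : ℕ) : ℝ) / ((Nat.log 2 (j ^ 2) : ℝ) + 7) ^ 2)) ^ 2 :=
      div_le_div_of_nonneg_right (variance_surprisal_le h hW hW' (j ^ 2)) (sq_nonneg _)
    _ = (3 * W) ^ 2 / κ ^ 2 * (((Nat.log 2 (j ^ 2) : ℝ) + 1) *
          ((Nat.log 2 (j ^ 2) : ℝ) + 7) ^ 4 / ((j ^ 2 : ℕ) : ℝ)) := by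
      field_simp
    _ ≤ (3 * W) ^ 2 / κ ^ 2 * (((Nat.log 2 (j ^ 2) : ℝ) + 7) *
          ((Nat.log 2 (j ^ 2) : ℝ) + 7) ^ 4 / ((j ^ 2 : ℕ) : ℝ)) := by
      gcongr
      norm_num
    _ = _ := by ring

lemma exists_bias_ae {p : ℝ} (hp : p ^ 3 = (1 - p) ^ 2) :
    ∃ (h : ℕ → unitInterval) (κ : ℝ), 0 < κ ∧ (∀ k, (h k : ℝ) ∈ Set.Ioo 0 1) ∧
      ∀ᵐ b ∂bitMeasure h, ∀ᶠ j : ℕ in atTop, ((j ^ 2 : ℕ) : ℝ) * -Real.log p +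
        κ * (((j ^ 2 : ℕ) : ℝ) / ((Nat.log 2 (j ^ 2) : ℝ) + 7) ^ 2) ≤
          surprisal (fun k => h k) (digitVal (goldenDigit b)) (j ^ 2) := by
  obtain ⟨h, κ, W, C, hκ, hh, hW, hW', hmean⟩ := exists_bias hp
  refine ⟨h, κ / 4, by positivity, hh, ?_⟩
  filter_upwards [ae_eventually_abs_sub_integral_lt
    (fun j => memLp_surprisal h (fun k => h k) ((j + 1) ^ 2) 2)
    (t := fun j => κ / 2 * ((((j + 1) ^ 2 : ℕ) : ℝ) / ((Nat.log 2 ((j + 1) ^ 2) : ℝ) + 7) ^ 2))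
    (fun j => by positivity)
    ((summable_nat_add_iff 1).2 (summable_variance_surprisal_div_sq hW hW' (κ / 2)))] with b hb
  rw [← map_add_atTop_eq_nat 1, eventually_map]
  filter_upwards [hb, ((tendsto_pow_atTop two_ne_zero).comp (tendsto_add_atTop_nat 1)).eventually
    (eventually_natLog_add_one_le C (show 0 < κ / 4 by positivity))] with j hdev hsmall
  rw [integral_surprisal] at hdev
  simp only [Function.comp_apply] at hsmall
  linarith [hmean ((j + 1) ^ 2), (abs_lt.1 hdev).1]

/-- The real number with binary digits `a 1, a 2, …`. -/
noncomputable def binaryReal (a : ℕ → Bool) : ℝ :=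
  Real.ofDigits fun k => finTwoEquiv.symm (a (k + 1))

/-- The integer with binary digits `a 1, …, a n`, most significant first. It encodes the prefix of
length `n` of a sequence of digits. -/
def wordCode (a : ℕ → Bool) : ℕ → ℕ
  | 0 => 0
  | n + 1 => 2 * wordCode a n + (a (n + 1)).toNat

lemma ofDigitsTerm_finTwoEquiv (a : ℕ → Bool) (k : ℕ) :
    Real.ofDigitsTerm (fun k => finTwoEquiv.symm (a (k + 1))) k =
      digitVal a (k + 1) / 2 ^ (k + 1) := by
  rw [Real.ofDigitsTerm, digitVal, Nat.cast_ofNat, div_eq_mul_inv]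
  cases a (k + 1) <;> simp [finTwoEquiv]

lemma hasSum_binaryReal (a : ℕ → Bool) :
    HasSum (fun k : ℕ => digitVal a (k + 1) / 2 ^ (k + 1)) (binaryReal a) := by
  simp_rw [← ofDigitsTerm_finTwoEquiv]
  exact Real.summable_ofDigitsTerm.hasSum

lemma XiG_eq_image : XiG = binaryReal '' {a | IsGolden a} := by
  ext x
  constructor
  · rintro ⟨a, h01, hgold, hsum⟩
    refine ⟨fun k => decide (k ≠ 0 ∧ a k = 1), fun k hk => ?_, ?_⟩
    · rw [decide_eq_true_eq] at hk
      have hprod := hgold k (Nat.one_le_iff_ne_zero.2 hk.1)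
      rw [hk.2, one_mul] at hprod
      simp [hprod]
    · refine (hasSum_binaryReal _).unique ?_
      convert! hsum using 3 with k
      rcases h01 (k + 1) with h | h <;> simp [digitVal, h]
  · rintro ⟨a, hgold, rfl⟩
    refine ⟨fun k => (a k).toNat, fun k => ?_, fun k _ => ?_, ?_⟩
    · cases a k <;> simp
    · cases h : a k
      · simp [h]
      · simp [hgold k h]
    · convert! hasSum_binaryReal a using 3 with k
      cases h : a (k + 1) <;> simp [digitVal, h]

lemma measurable_binaryReal_goldenDigit : Measurable fun b => binaryReal (goldenDigit b) := by
  refine Real.continuous_ofDigits.measurable.comp (measurable_pi_lambda _ fun k => ?_)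
  exact (measurable_of_countable finTwoEquiv.symm).comp
    (measurable_of_dependsOn (dependsOn_goldenDigit (k + 1)))

lemma sum_range_digitVal (a : ℕ → Bool) (n : ℕ) :
    ∑ k ∈ Finset.range n, digitVal a (k + 1) / 2 ^ (k + 1) = wordCode a n / 2 ^ n := by
  induction n with
  | zero => simp [wordCode]
  | succ n ih =>
    rw [Finset.sum_range_succ, ih, wordCode, digitVal, pow_succ]
    cases a (n + 1) <;> (simp; field_simp)

lemma binaryReal_mem_Icc (a : ℕ → Bool) (n : ℕ) :
    binaryReal a ∈ Set.Icc ((wordCode a n : ℝ) / 2 ^ n) ((wordCode a n + 1 : ℝ) / 2 ^ n) := by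
  rw [binaryReal, Real.ofDigits_eq_sum_add_ofDigits _ n]
  simp_rw [ofDigitsTerm_finTwoEquiv]
  rw [sum_range_digitVal, add_div, one_div, Nat.cast_ofNat]
  exact ⟨le_add_of_nonneg_right (mul_nonneg (by positivity) (Real.ofDigits_nonneg _)),
    add_le_add_right (mul_le_of_le_one_right (by positivity) (Real.ofDigits_le_one _)) _⟩

lemma wordCode_eq_iff {a a' : ℕ → Bool} (h0 : a 0 = a' 0) (n : ℕ) :
    wordCode a n = wordCode a' n ↔ ∀ k ≤ n, a k = a' k := by
  induction n with
  | zero => simp [wordCode, h0]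
  | succ n ih =>
    have hdigit : 2 * wordCode a n + (a (n + 1)).toNat = 2 * wordCode a' n + (a' (n + 1)).toNat ↔
        wordCode a n = wordCode a' n ∧ a (n + 1) = a' (n + 1) := by
      cases a (n + 1) <;> cases a' (n + 1) <;> simp <;> omega
    rw [wordCode, wordCode, hdigit, ih]
    simp only [Nat.le_succ_iff, or_imp, forall_and, forall_eq]

lemma wordCode_le_add_two {a a' : ℕ → Bool} {n : ℕ}
    (h : |binaryReal a - binaryReal a'| ≤ 1 / 2 ^ n) : wordCode a n ≤ wordCode a' n + 2 := by
  have hle : (wordCode a n : ℝ) / 2 ^ n ≤ (wordCode a' n + 1 : ℝ) / 2 ^ n + 1 / 2 ^ n := by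
    linarith [(binaryReal_mem_Icc a n).1, (binaryReal_mem_Icc a' n).2, (abs_le.1 h).2]
  rw [← add_div, div_le_div_iff_of_pos_right (by positivity)] at hle
  have : (wordCode a n : ℝ) ≤ (wordCode a' n + 2 : ℕ) := by
    push_cast
    linarith
  exact_mod_cast this

section MassDistribution

variable {h : ℕ → unitInterval} {E : Set (ℕ → Bool)}

lemma bitMeasure_wordCode_le (hh : ∀ k, (h k : ℝ) ∈ Set.Ioo 0 1) {n : ℕ} {B : ℝ}
    (hE : ∀ b ∈ E, B ≤ surprisal (fun k => h k) (digitVal (goldenDigit b)) n) (c : ℕ) :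
    bitMeasure h {b ∈ E | wordCode (goldenDigit b) n = c} ≤ ENNReal.ofReal (Real.exp (-B)) := by
  rcases {b ∈ E | wordCode (goldenDigit b) n = c}.eq_empty_or_nonempty with hempty | ⟨b₀, hb₀, hc⟩
  · simp [hempty]
  · calc bitMeasure h {b ∈ E | wordCode (goldenDigit b) n = c}
        ≤ bitMeasure h {b | ∀ k ≤ n, goldenDigit b k = goldenDigit b₀ k} :=
          measure_mono fun b hb =>
            (wordCode_eq_iff (by rw [goldenDigit_zero, goldenDigit_zero]) n).1 (hb.2.trans hc.symm)
      _ = ENNReal.ofReal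
            (Real.exp (-surprisal (fun k => h k) (digitVal (goldenDigit b₀)) n)) :=
          bitMeasure_goldenDigit_prefix hh (isGolden_goldenDigit b₀) n
      _ ≤ ENNReal.ofReal (Real.exp (-B)) :=
          ENNReal.ofReal_le_ofReal (Real.exp_le_exp.2 (neg_le_neg (hE b₀ hb₀)))

lemma bitMeasure_preimage_inter_le (hh : ∀ k, (h k : ℝ) ∈ Set.Ioo 0 1) {n : ℕ} {B : ℝ}
    (hE : ∀ b ∈ E, B ≤ surprisal (fun k => h k) (digitVal (goldenDigit b)) n) {U : Set ℝ}
    (hU : Metric.ediam U ≤ ENNReal.ofReal (1 / 2 ^ n)) :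
    bitMeasure h ((fun b => binaryReal (goldenDigit b)) ⁻¹' U ∩ E) ≤
      ENNReal.ofReal (5 * Real.exp (-B)) := by
  rcases ((fun b => binaryReal (goldenDigit b)) ⁻¹' U ∩ E).eq_empty_or_nonempty with
    hempty | ⟨b₀, hb₀⟩
  · simp [hempty]
  have hclose {b b' : ℕ → Bool} (hb : binaryReal (goldenDigit b) ∈ U)
      (hb' : binaryReal (goldenDigit b') ∈ U) :
      wordCode (goldenDigit b) n ≤ wordCode (goldenDigit b') n + 2 := by
    refine wordCode_le_add_two ?_
    rw [← Real.dist_eq, ← ENNReal.ofReal_le_ofReal_iff (by positivity), ← edist_dist]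
    exact (Metric.edist_le_ediam_of_mem hb hb').trans hU
  set c₀ := wordCode (goldenDigit b₀) n
  calc bitMeasure h ((fun b => binaryReal (goldenDigit b)) ⁻¹' U ∩ E)
      ≤ bitMeasure h (⋃ c ∈ Finset.Icc (c₀ - 2) (c₀ + 2),
          {b ∈ E | wordCode (goldenDigit b) n = c}) := by
        refine measure_mono fun b hb => ?_
        simp only [Set.mem_iUnion]
        exact ⟨_, Finset.mem_Icc.2 ⟨Nat.sub_le_of_le_add (hclose hb₀.1 hb.1), hclose hb.1 hb₀.1⟩,
          hb.2, rfl⟩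
    _ ≤ (Finset.Icc (c₀ - 2) (c₀ + 2)).card • ENNReal.ofReal (Real.exp (-B)) :=
        (measure_biUnion_finset_le _ _).trans
          (Finset.sum_le_card_nsmul _ _ _ fun c _ => bitMeasure_wordCode_le hh hE c)
    _ ≤ 5 • ENNReal.ofReal (Real.exp (-B)) :=
        nsmul_le_nsmul_left zero_le (by rw [Nat.card_Icc]; omega)
    _ = ENNReal.ofReal (5 * Real.exp (-B)) := by
        rw [← ENNReal.ofReal_nsmul, nsmul_eq_mul, Nat.cast_ofNat]

lemma bitMeasure_preimage_inter_le_gauge (hh : ∀ k, (h k : ℝ) ∈ Set.Ioo 0 1) {B : ℕ → ℝ}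
    (hB : Tendsto B atTop atTop) {J : ℕ} (hE : ∀ b ∈ E, ∀ j ≥ J,
      B j ≤ surprisal (fun k => h k) (digitVal (goldenDigit b)) (j ^ 2))
    {φ : ℝ → ℝ} {ε : ℝ} (hε : 0 < ε) (hφ : ∀ d, 0 < d → d ≤ ε →
      ∃ j ≥ J, d ≤ 1 / 2 ^ (j ^ 2) ∧ 5 * Real.exp (-B j) ≤ φ d)
    {U : Set ℝ} (hU : Metric.ediam U ≤ ENNReal.ofReal ε) :
    bitMeasure h ((fun b => binaryReal (goldenDigit b)) ⁻¹' U ∩ E) ≤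
      ENNReal.ofReal (φ (Metric.ediam U).toReal) := by
  have hfinite : Metric.ediam U ≠ ⊤ := ne_top_of_le_ne_top ENNReal.ofReal_ne_top hU
  rcases eq_or_ne (Metric.ediam U) 0 with hzero | hpos
  · have hlim : Tendsto (fun j => ENNReal.ofReal (5 * Real.exp (-B j))) atTop (𝓝 0) := by
      simpa using ENNReal.tendsto_ofReal
        ((Real.tendsto_exp_neg_atTop_nhds_zero.comp hB).const_mul 5)
    refine (ge_of_tendsto hlim ?_).trans zero_le
    filter_upwards [eventually_ge_atTop J] with j hj
    exact bitMeasure_preimage_inter_le hh (fun b hb => hE b hb j hj) (hzero.le.trans zero_le)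
  · obtain ⟨j, hj, hdiam, hgauge⟩ := hφ (Metric.ediam U).toReal (ENNReal.toReal_pos hpos hfinite)
      (ENNReal.toReal_le_of_le_ofReal hε.le hU)
    exact (bitMeasure_preimage_inter_le hh (fun b hb => hE b hb j hj)
      ((ENNReal.le_ofReal_iff_toReal_le hfinite (by positivity)).2 hdiam)).trans
      (ENNReal.ofReal_le_ofReal hgauge)

end MassDistribution

lemma exists_measure_setOf_forall_ge_ne_zero {Ω : Type*} [MeasurableSpace Ω] {μ : Measure Ω}
    [NeZero μ] {P : ℕ → Ω → Prop} (hP : ∀ᵐ ω ∂μ, ∀ᶠ j in atTop, P j ω) :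
    ∃ J, μ {ω | ∀ j ≥ J, P j ω} ≠ 0 := by
  by_contra! hnull
  refine NeZero.ne μ (ae_eq_bot.1 (eventually_false_iff_eq_bot.1 ?_))
  filter_upwards [hP, measure_eq_zero_iff_ae_notMem.1 (measure_iUnion_null hnull)] with ω hω hω'
  obtain ⟨J, hJ⟩ := eventually_atTop.1 hω
  exact hω' (Set.mem_iUnion.2 ⟨J, hJ⟩)

lemma gaugeMeasure_XiG_ne_zero {h : ℕ → unitInterval} (hh : ∀ k, (h k : ℝ) ∈ Set.Ioo 0 1)
    {B : ℕ → ℝ} (hB : Tendsto B atTop atTop) (hsurprisal : ∀ᵐ b ∂bitMeasure h, ∀ᶠ j : ℕ in atTop,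
      B j ≤ surprisal (fun k => h k) (digitVal (goldenDigit b)) (j ^ 2))
    {φ : ℝ → ℝ} (hφ : ∀ J : ℕ, ∃ ε > 0, ∀ d, 0 < d → d ≤ ε →
      ∃ j ≥ J, d ≤ 1 / 2 ^ (j ^ 2) ∧ 5 * Real.exp (-B j) ≤ φ d) :
    gaugeMeasure φ XiG ≠ 0 := by
  obtain ⟨J, hJ⟩ := exists_measure_setOf_forall_ge_ne_zero hsurprisal
  set E := {b | ∀ j ≥ J, B j ≤ surprisal (fun k => h k) (digitVal (goldenDigit b)) (j ^ 2)}
  have hmeas := measurable_binaryReal_goldenDigit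
  set ν := ((bitMeasure h).restrict E).map fun b => binaryReal (goldenDigit b) with hν
  obtain ⟨ε, hε, hεφ⟩ := hφ J
  have hle : ν ≤ gaugeMeasure φ := by
    refine Measure.le_mkMetric _ _ (ENNReal.ofReal ε) (ENNReal.ofReal_pos.2 hε) fun s hs => ?_
    rw [← Metric.ediam_closure s] at hs ⊢
    refine (measure_mono subset_closure).trans ?_
    rw [hν, Measure.map_apply hmeas isClosed_closure.measurableSet,
      Measure.restrict_apply (hmeas isClosed_closure.measurableSet)]
    exact bitMeasure_preimage_inter_le_gauge hh hB (fun b hb => hb) hε hεφ hs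
  have hrange : (fun b => binaryReal (goldenDigit b)) ⁻¹' XiG = Set.univ := by
    refine Set.eq_univ_of_forall fun b => ?_
    rw [Set.mem_preimage, XiG_eq_image]
    exact Set.mem_image_of_mem _ (isGolden_goldenDigit b)
  intro hzero
  refine hJ (le_antisymm ?_ zero_le)
  calc bitMeasure h E = (bitMeasure h).restrict E
        ((fun b => binaryReal (goldenDigit b)) ⁻¹' XiG) := by
        rw [hrange, Measure.restrict_apply_univ]
    _ ≤ ν XiG := Measure.le_map_apply hmeas.aemeasurable XiG
    _ ≤ gaugeMeasure φ XiG := hle XiG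
    _ = 0 := hzero

lemma eventually_linear_le {κ : ℝ} (hκ : 0 < κ) (A B : ℝ) :
    ∀ᶠ j : ℕ in atTop,
      A + B * j ≤ κ * (((j ^ 2 : ℕ) : ℝ) / ((Nat.log 2 (j ^ 2) : ℝ) + 7) ^ 2) := by
  have hlog : (fun j : ℕ => ((Nat.log 2 (j ^ 2) : ℝ) + 7) ^ 2) =o[atTop] fun j : ℕ => (j : ℝ) := by
    refine ((isLittleO_natLog_add_pow_rpow 7 2 one_half_pos).comp_tendsto
      (tendsto_pow_atTop two_ne_zero)).congr (fun _ => rfl) fun j => ?_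
    rw [Function.comp_apply, Nat.cast_pow, ← Real.sqrt_eq_rpow, Real.sqrt_sq (Nat.cast_nonneg j)]
  have hlinear : (fun j : ℕ => A + B * (j : ℝ)) =O[atTop] fun j : ℕ => (j : ℝ) :=
    (Asymptotics.isLittleO_const_left.2 (Or.inr (tendsto_norm_atTop_atTop.comp
      tendsto_natCast_atTop_atTop))).isBigO.add (Asymptotics.isBigO_const_mul_self B _ _)
  filter_upwards [(hlinear.mul_isLittleO hlog).bound hκ] with j hj
  rw [← sq, ← Nat.cast_pow, Real.norm_natCast] at hj
  rw [← mul_div_assoc, le_div_iff₀ (by positivity)]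
  exact (Real.le_norm_self _).trans hj

lemma exists_sq_le_le {N : ℕ} (hN : 1 ≤ N) {y : ℝ} (hy : (N : ℝ) ^ 2 ≤ y) :
    ∃ j ≥ N, (j : ℝ) ^ 2 ≤ y ∧ y ≤ (j : ℝ) ^ 2 + 3 * j := by
  have hNj : N ≤ ⌊√y⌋₊ := Nat.le_floor (Real.le_sqrt_of_sq_le hy)
  have hj : (1 : ℝ) ≤ ⌊√y⌋₊ := by exact_mod_cast hN.trans hNj
  refine ⟨⌊√y⌋₊, hNj, (Real.le_sqrt' (by linarith)).1 (Nat.floor_le (Real.sqrt_nonneg y)), ?_⟩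
  have hlt : y ≤ ((⌊√y⌋₊ : ℝ) + 1) ^ 2 :=
    (Real.sqrt_le_left (by positivity)).1 (Nat.lt_floor_add_one _).le
  nlinarith

lemma div_log_sq_le {n : ℕ} (hn : 9 ≤ Nat.log 2 n) {u : ℝ} (hlow : n * Real.log 2 ≤ u)
    (hup : u ≤ 4 * n) :
    u / Real.log u ^ 2 ≤ 64 * (n / ((Nat.log 2 n : ℝ) + 7) ^ 2) := by
  have hpow : (2 : ℝ) ^ Nat.log 2 n ≤ n := by
    exact_mod_cast Nat.pow_log_le_self 2 (by rintro rfl; simp at hn)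
  have hn' : (9 : ℝ) ≤ Nat.log 2 n := by exact_mod_cast hn
  have hhalf : (1 : ℝ) / 2 ≤ Real.log 2 := by linarith [Real.log_two_gt_d9]
  have hlog : ((Nat.log 2 n : ℝ) + 7) / 4 ≤ Real.log u := by
    have hle : (2 : ℝ) ^ Nat.log 2 n / 2 ≤ u := by nlinarith
    have := Real.log_le_log (by positivity) hle
    rw [Real.log_div (by positivity) two_ne_zero, Real.log_pow] at this
    nlinarith
  calc u / Real.log u ^ 2 ≤ 4 * n / (((Nat.log 2 n : ℝ) + 7) / 4) ^ 2 := by gcongr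
    _ = 64 * (n / ((Nat.log 2 n : ℝ) + 7) ^ 2) := by
      field_simp
      ring

lemma phiGauge_eq_exp (s c : ℝ) {t : ℝ} (ht : t ∈ Set.Ioc 0 1) :
    phiGauge s c t = Real.exp
      (-(s * -Real.log t + c * (-Real.log t / Real.log (-Real.log t) ^ 2))) := by
  rw [phiGauge, abs_of_nonpos (Real.log_nonpos ht.1.le ht.2), Real.rpow_def_of_pos ht.1,
    ← Real.exp_add]
  ring_nf

-- For `j = ⌊√y⌋`, `y = -log₂ d`, replacing `y` by `j ^ 2` costs `O(j)`, which half of the term in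
-- `κ` absorbs; the other half absorbs the term in `c`.
lemma exists_le_phiGauge {κ s c : ℝ} (hκ : 0 < κ) (hs : 0 < s) (hc : c ≤ κ / 128) (J : ℕ) :
    ∃ ε > 0, ∀ d : ℝ, 0 < d → d ≤ ε → ∃ j ≥ J, d ≤ 1 / 2 ^ (j ^ 2) ∧
      5 * Real.exp (-(((j ^ 2 : ℕ) : ℝ) * (s * Real.log 2) +
        κ * (((j ^ 2 : ℕ) : ℝ) / ((Nat.log 2 (j ^ 2) : ℝ) + 7) ^ 2))) ≤ phiGauge s c d := by
  have hlog2 : 0 < Real.log 2 := Real.log_pos one_lt_two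
  have hlarge : ∀ᶠ j : ℕ in atTop, 9 ≤ Nat.log 2 (j ^ 2) := by
    filter_upwards [eventually_ge_atTop (2 ^ 9)] with j hj
    exact Nat.le_log_of_pow_le one_lt_two (hj.trans (Nat.le_self_pow two_ne_zero j))
  obtain ⟨N, hN⟩ := eventually_atTop.1
    ((eventually_linear_le (half_pos hκ) (Real.log 5) (3 * (s * Real.log 2))).and hlarge)
  refine ⟨1 / 2 ^ ((max (max J 1) N) ^ 2), by positivity, fun d hd hdε => ?_⟩
  have hle (j : ℕ) : d ≤ 1 / 2 ^ (j ^ 2) ↔ (j : ℝ) ^ 2 ≤ -Real.log d / Real.log 2 := by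
    rw [← Real.log_le_log_iff hd (by positivity), one_div, Real.log_inv, Real.log_pow,
      le_div_iff₀ hlog2, Nat.cast_pow, le_neg]
  obtain ⟨j, hj, hjlow, hjup⟩ := exists_sq_le_le (by simp) ((hle _).1 hdε)
  simp only [ge_iff_le, max_le_iff] at hj
  obtain ⟨hlin, hlog⟩ := hN j hj.2
  refine ⟨j, hj.1.1, (hle j).2 hjlow, ?_⟩
  have hd1 : d ≤ 1 := hdε.trans (div_le_self zero_le_one (one_le_pow₀ one_le_two))
  have hjone : (1 : ℝ) ≤ j := by exact_mod_cast hj.1.2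
  rw [le_div_iff₀ hlog2] at hjlow
  rw [div_le_iff₀ hlog2] at hjup
  have hquot : -Real.log d / Real.log (-Real.log d) ^ 2 ≤
      64 * (((j ^ 2 : ℕ) : ℝ) / ((Nat.log 2 (j ^ 2) : ℝ) + 7) ^ 2) := by
    refine div_log_sq_le hlog (by exact_mod_cast hjlow) ?_
    push_cast
    nlinarith [Real.log_two_lt_d9]
  have hcorr := mul_le_mul hc hquot
    (div_nonneg (neg_nonneg.2 (Real.log_nonpos hd.le hd1)) (sq_nonneg _)) (by positivity)
  have hmain := mul_le_mul_of_nonneg_left hjup hs.le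
  rw [phiGauge_eq_exp s c ⟨hd, hd1⟩, ← Real.exp_log (show (0 : ℝ) < 5 by norm_num), ← Real.exp_add,
    Real.exp_le_exp]
  push_cast at hlin hcorr ⊢
  linarith

lemma exists_phiGauge_ne_zero {p : ℝ} (hp : p ^ 3 = (1 - p) ^ 2) :
    ∃ c₀ > 0, ∀ c < c₀, gaugeMeasure (phiGauge (-Real.logb 2 p) c) XiG ≠ 0 := by
  obtain ⟨h, κ, hκ, hh, hae⟩ := exists_bias_ae hp
  have hpIoo := mem_Ioo_of_cube_eq hp
  have hp0 : 0 < p := by linarith [hpIoo.1]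
  have hs : 0 < -Real.logb 2 p := neg_pos.2 (Real.logb_neg one_lt_two hp0 hpIoo.2)
  have hL : -Real.log p = -Real.logb 2 p * Real.log 2 := by
    rw [neg_mul, Real.logb, div_mul_cancel₀ _ (Real.log_pos one_lt_two).ne']
  rw [hL] at hae
  refine ⟨κ / 128, by positivity, fun c hc => gaugeMeasure_XiG_ne_zero hh ?_ hae
    (exists_le_phiGauge hκ hs hc.le)⟩
  have hsq : Tendsto (fun j : ℕ => ((j ^ 2 : ℕ) : ℝ)) atTop atTop :=
    tendsto_natCast_atTop_atTop.comp (tendsto_pow_atTop two_ne_zero)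
  refine tendsto_atTop_mono (fun j => ?_)
    (hsq.atTop_mul_const (mul_pos hs (Real.log_pos one_lt_two)))
  exact le_add_of_nonneg_right (by positivity)

lemma mkMetric_eq_zero_of_ne_top {X : Type*} [EMetricSpace X] [MeasurableSpace X] [BorelSpace X]
    {m₁ m₂ : ℝ≥0∞ → ℝ≥0∞} (hm : ∀ M : ℝ≥0, 0 < M → ∀ᶠ d in 𝓝 0, m₁ d ≤ M * m₂ d) {A : Set X}
    (hA : (Measure.mkMetric m₂ : Measure X) A ≠ ⊤) : (Measure.mkMetric m₁ : Measure X) A = 0 := by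
  have hle : ∀ᶠ M : ℝ≥0 in 𝓝[>] 0,
      (Measure.mkMetric m₁ : Measure X) A ≤ M * (Measure.mkMetric m₂ : Measure X) A := by
    filter_upwards [self_mem_nhdsWithin] with M hM
    exact Measure.mkMetric_mono_smul ENNReal.coe_ne_top (ENNReal.coe_ne_zero.2 hM.ne')
      (nhdsWithin_le_nhds (hm M hM)) A
  have hlim : Tendsto (fun M : ℝ≥0 => M * (Measure.mkMetric m₂ : Measure X) A) (𝓝[>] 0) (𝓝 0) := by
    have hcoe : Tendsto (fun M : ℝ≥0 => (M : ℝ≥0∞)) (𝓝[>] 0) (𝓝 0) :=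
      (ENNReal.tendsto_coe.2 tendsto_id).mono_left nhdsWithin_le_nhds
    simpa using ENNReal.Tendsto.mul_const hcoe (Or.inr hA)
  exact nonpos_iff_eq_zero.1 (ge_of_tendsto hlim hle)

lemma mkMetric_not_sigmaFinite {X : Type*} [EMetricSpace X] [MeasurableSpace X] [BorelSpace X]
    {m₁ m₂ : ℝ≥0∞ → ℝ≥0∞} (hm : ∀ M : ℝ≥0, 0 < M → ∀ᶠ d in 𝓝 0, m₁ d ≤ M * m₂ d) {A : Set X}
    (hne : (Measure.mkMetric m₁ : Measure X) A ≠ 0) :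
    ¬ SigmaFinite ((Measure.mkMetric m₂ : Measure X).restrict A) := by
  intro hσ
  set S := spanningSets ((Measure.mkMetric m₂ : Measure X).restrict A) with hS
  have hnull (i : ℕ) : (Measure.mkMetric m₁ : Measure X) (S i ∩ A) = 0 := by
    refine mkMetric_eq_zero_of_ne_top hm ?_
    rw [← Measure.restrict_apply (measurableSet_spanningSets _ i)]
    exact (measure_spanningSets_lt_top _ i).ne
  refine hne (measure_mono_null ?_ (measure_iUnion_null hnull))
  rw [← Set.iUnion_inter, hS, iUnion_spanningSets, Set.univ_inter]

lemma measure_eq_top_of_not_sigmaFinite {α : Type*} [MeasurableSpace α] {μ : Measure α} {A : Set α}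
    (h : ¬ SigmaFinite (μ.restrict A)) : μ A = ⊤ := by
  by_contra hA
  have := isFiniteMeasure_restrict.2 hA
  exact h inferInstance

lemma eventually_toReal_of_nhdsGT {P : ℝ → Prop} (h0 : P 0) (h : ∀ᶠ t in 𝓝[>] (0 : ℝ), P t) :
    ∀ᶠ d in 𝓝 (0 : ℝ≥0∞), P d.toReal := by
  have hright : ∀ᶠ t in 𝓝[≥] (0 : ℝ), P t := by
    rw [← Set.Ioi_insert, nhdsWithin_insert, eventually_sup]
    exact ⟨h0, h⟩
  have htoReal : Tendsto ENNReal.toReal (𝓝 0) (𝓝[≥] (0 : ℝ)) :=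
    tendsto_nhdsWithin_of_tendsto_nhds_of_eventually_within _
      (ENNReal.tendsto_toReal ENNReal.zero_ne_top)
      (Eventually.of_forall fun d => ENNReal.toReal_nonneg)
  exact htoReal.eventually hright

lemma tendsto_abs_log_nhdsGT : Tendsto (fun t : ℝ => |Real.log t|) (𝓝[>] 0) atTop :=
  tendsto_abs_atBot_atTop.comp Real.tendsto_log_nhdsGT_zero

lemma tendsto_div_log_sq_atTop : Tendsto (fun u : ℝ => u / Real.log u ^ 2) atTop atTop := by
  have hsmall : Tendsto (fun u : ℝ => Real.log u ^ 2 / u) atTop (𝓝[>] 0) := by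
    refine tendsto_nhdsWithin_of_tendsto_nhds_of_eventually_within _
      (Real.isLittleO_pow_log_id_atTop (n := 2)).tendsto_div_nhds_zero ?_
    filter_upwards [eventually_gt_atTop 1] with u hu
    exact div_pos (pow_pos (Real.log_pos hu) 2) (by linarith)
  exact hsmall.inv_tendsto_nhdsGT_zero.congr fun u => inv_div _ _

lemma phiGauge_zero_right {s : ℝ} (hs : s ≠ 0) (c : ℝ) : phiGauge s c 0 = 0 := by
  rw [phiGauge, Real.zero_rpow hs, zero_mul]

lemma eventually_phiGauge_le {s c c' : ℝ} (hs : s ≠ 0) (hc : c < c') {M : ℝ} (hM : 0 < M) :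
    ∀ᶠ d in 𝓝 (0 : ℝ≥0∞), phiGauge s c' d.toReal ≤ M * phiGauge s c d.toReal := by
  refine eventually_toReal_of_nhdsGT (P := fun t => phiGauge s c' t ≤ M * phiGauge s c t) ?_ ?_
  · rw [phiGauge_zero_right hs, phiGauge_zero_right hs, mul_zero]
  filter_upwards [self_mem_nhdsWithin, (tendsto_div_log_sq_atTop.comp
    tendsto_abs_log_nhdsGT).eventually_ge_atTop (-Real.log M / (c' - c))] with t ht hlarge
  rw [Function.comp_apply, div_le_iff₀ (by linarith)] at hlarge
  rw [phiGauge, phiGauge, mul_left_comm]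
  refine mul_le_mul_of_nonneg_left ?_ (Real.rpow_nonneg (le_of_lt ht) s)
  calc Real.exp (-c' * (|Real.log t| / Real.log |Real.log t| ^ 2))
      ≤ Real.exp (Real.log M + -c * (|Real.log t| / Real.log |Real.log t| ^ 2)) :=
        Real.exp_le_exp.2 (by linarith)
    _ = M * Real.exp (-c * (|Real.log t| / Real.log |Real.log t| ^ 2)) := by
        rw [Real.exp_add, Real.exp_log hM]

lemma not_sigmaFinite_phiGauge {s c c' : ℝ} (hs : s ≠ 0) (hc : c < c') {A : Set ℝ}
    (hne : gaugeMeasure (phiGauge s c') A ≠ 0) :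
    ¬ SigmaFinite ((gaugeMeasure (phiGauge s c)).restrict A) := by
  refine mkMetric_not_sigmaFinite (fun M hM => ?_) hne
  filter_upwards [eventually_phiGauge_le hs hc hM] with d hd
  rw [← ENNReal.ofReal_coe_nnreal, ← ENNReal.ofReal_mul M.coe_nonneg]
  exact ENNReal.ofReal_le_ofReal hd

lemma eventually_rpow_eq_phiGauge {s : ℝ} (hs : 0 ≤ s) :
    ∀ᶠ d in 𝓝 (0 : ℝ≥0∞), d ^ s = ENNReal.ofReal (phiGauge s 0 d.toReal) := by
  filter_upwards [gt_mem_nhds ENNReal.zero_lt_top] with d hd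
  rw [phiGauge, neg_zero, zero_mul, Real.exp_zero, mul_one,
    ← ENNReal.ofReal_rpow_of_nonneg ENNReal.toReal_nonneg hs, ENNReal.ofReal_toReal hd.ne]

lemma hausdorffMeasure_eq_gaugeMeasure {s : ℝ} (hs : 0 ≤ s) :
    (Measure.hausdorffMeasure s : Measure ℝ) = gaugeMeasure (phiGauge s 0) :=
  le_antisymm
    (Measure.mkMetric_mono ((eventually_rpow_eq_phiGauge hs).mono fun _ hd => hd.le))
    (Measure.mkMetric_mono ((eventually_rpow_eq_phiGauge hs).mono fun _ hd => hd.ge))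

lemma eventually_rpow_le_psiGauge {s d : ℝ} (hs : 0 < s) (hd : s < d) :
    ∀ᶠ r in 𝓝 (0 : ℝ≥0∞), r ^ d ≤ ENNReal.ofReal (psiGauge s 1 r.toReal) := by
  have hreal : ∀ᶠ r in 𝓝 (0 : ℝ≥0∞), phiGauge d 0 r.toReal ≤ psiGauge s 1 r.toReal := by
    refine eventually_toReal_of_nhdsGT (P := fun t => phiGauge d 0 t ≤ psiGauge s 1 t) ?_ ?_
    · rw [phiGauge_zero_right (hs.trans hd).ne', psiGauge, Real.zero_rpow hs.ne', zero_mul]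
    filter_upwards [Ioo_mem_nhdsGT (show (0 : ℝ) < 1 by norm_num),
      (Real.tendsto_log_atTop.comp tendsto_abs_log_nhdsGT).eventually_ge_atTop
        (d - s)⁻¹] with t ht hlarge
    have hdiv : |Real.log t| / Real.log |Real.log t| ≤ |Real.log t| * (d - s) := by
      rw [Function.comp_apply] at hlarge
      rw [div_eq_mul_inv]
      exact mul_le_mul_of_nonneg_left (inv_le_of_inv_le₀ (sub_pos.2 hd) hlarge) (abs_nonneg _)
    rw [phiGauge, psiGauge, Real.rpow_one, neg_zero, zero_mul, Real.exp_zero, mul_one,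
      Real.rpow_def_of_pos ht.1, Real.rpow_def_of_pos ht.1, ← Real.exp_add, Real.exp_le_exp]
    rw [abs_of_neg (Real.log_neg ht.1 ht.2)] at hdiv ⊢
    linarith
  filter_upwards [hreal, eventually_rpow_eq_phiGauge (hs.trans hd).le] with r hle heq
  rw [heq]
  exact ENNReal.ofReal_le_ofReal hle

lemma dimH_eq_of_gaugeMeasure_psiGauge_eq_zero {s : ℝ} (hs : 0 < s) {A : Set ℝ}
    (hlow : (Measure.hausdorffMeasure s : Measure ℝ) A ≠ 0)
    (hup : gaugeMeasure (psiGauge s 1) A = 0) : dimH A = ENNReal.ofReal s := by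
  apply le_antisymm
  · refine dimH_le fun d hd => le_of_not_gt fun hlt => ?_
    have hsd : s < d := (Real.toNNReal_lt_iff_lt_coe hs.le).1 (ENNReal.coe_lt_coe.1 hlt)
    have hzero : (Measure.hausdorffMeasure (d : ℝ) : Measure ℝ) A = 0 :=
      nonpos_iff_eq_zero.1 (hup ▸ Measure.mkMetric_mono (eventually_rpow_le_psiGauge hs hsd) A)
    exact ENNReal.zero_ne_top (hzero.symm.trans hd)
  · refine le_dimH_of_hausdorffMeasure_ne_zero (d := s.toNNReal) ?_
    rwa [Real.coe_toNNReal s hs.le]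

lemma tendsto_atBot_of_div_succ_le_sub {f : ℕ → ℝ} {c : ℝ} (hc : 0 < c)
    (hf : ∀ᶠ m : ℕ in atTop, c / (m + 1) ≤ f m - f (m + 1)) : Tendsto f atTop atBot := by
  obtain ⟨N, hN⟩ := eventually_atTop.1 hf
  set S : ℕ → ℝ := fun m => ∑ i ∈ Finset.range m, 1 / ((i : ℝ) + 1) with hS
  have hbound (m : ℕ) (hm : N ≤ m) : f m ≤ f N + c * S N - c * S m := by
    induction m, hm using Nat.le_induction with
    | base => linarith
    | succ m hm ih =>
      have hnext : c * S (m + 1) = c * S m + c / (m + 1) := by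
        simp only [hS, Finset.sum_range_succ, mul_add, mul_one_div]
      linarith [hN m hm]
  refine tendsto_atBot_mono' atTop ((eventually_ge_atTop N).mono hbound) ?_
  simp only [sub_eq_add_neg]
  exact tendsto_atBot_add_const_left _ _ <| tendsto_neg_atTop_atBot.comp <|
    Real.tendsto_sum_range_one_div_nat_succ_atTop.const_mul_atTop hc

/- A discrete version of `-β' ≥ x⁻² + 2 |β| / x`, which has no solution that is bounded below: once
`β` is negative it decreases at least like `-log x`, and `x * β` does so as long as `β ≥ 0`. -/
lemma tendsto_atBot_of_riccati {β : ℕ → ℝ} (hβ : ∀ᶠ m : ℕ in atTop,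
    1 / ((m : ℝ) + 1) ^ 2 + 2 * |β (m + 1)| / (m + 1) ≤ β m - β (m + 1)) :
    Tendsto β atTop atBot := by
  obtain ⟨N, hN⟩ := eventually_atTop.1 hβ
  by_cases hneg : ∃ M ≥ N, β M < 0
  · obtain ⟨M, hMN, hM⟩ := hneg
    have hdecr (m : ℕ) (hm : M ≤ m) : β m ≤ β M := by
      induction m, hm using Nat.le_induction with
      | base => rfl
      | succ m hm ih =>
        have hnonneg : 0 ≤ 1 / ((m : ℝ) + 1) ^ 2 + 2 * |β (m + 1)| / (m + 1) := by positivity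
        linarith [hN m (hMN.trans hm)]
    refine tendsto_atBot_of_div_succ_le_sub (c := 2 * -β M) (by linarith) ?_
    filter_upwards [eventually_ge_atTop M] with m hm
    calc 2 * -β M / ((m : ℝ) + 1) ≤ 2 * |β (m + 1)| / (m + 1) := by
          gcongr
          exact (neg_le_neg (hdecr _ (hm.trans m.le_succ))).trans (neg_le_abs _)
      _ ≤ 1 / ((m : ℝ) + 1) ^ 2 + 2 * |β (m + 1)| / (m + 1) :=
          le_add_of_nonneg_left (by positivity)
      _ ≤ β m - β (m + 1) := hN m (hMN.trans hm)
  · push Not at hneg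
    have hlim : Tendsto (fun m : ℕ => m * β m) atTop atBot := by
      refine tendsto_atBot_of_div_succ_le_sub (c := 1 / 2) (by norm_num) ?_
      filter_upwards [eventually_ge_atTop N, eventually_ge_atTop 1] with m hm hm1
      have hm1' : (1 : ℝ) ≤ m := by exact_mod_cast hm1
      have hnext := hneg (m + 1) (hm.trans m.le_succ)
      have hstep := hN m hm
      rw [abs_of_nonneg hnext] at hstep
      calc 1 / 2 / ((m : ℝ) + 1) ≤ m * (1 / ((m : ℝ) + 1) ^ 2) := by
            rw [mul_one_div, div_le_div_iff₀ (by positivity) (by positivity)]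
            nlinarith
        _ ≤ m * (1 / ((m : ℝ) + 1) ^ 2) + β (m + 1) * (m - 1) / (m + 1) :=
            le_add_of_nonneg_right (by have := sub_nonneg.2 hm1'; positivity)
        _ = m * (1 / ((m : ℝ) + 1) ^ 2 + 2 * β (m + 1) / (m + 1)) - β (m + 1) := by
            field_simp
            ring
        _ ≤ m * (β m - β (m + 1)) - β (m + 1) := by gcongr
        _ = m * β m - (m + 1 : ℕ) * β (m + 1) := by push_cast; ring
    obtain ⟨m, hm, hlt⟩ := ((eventually_ge_atTop N).and (hlim.eventually_lt_atBot 0)).exists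
    exact absurd hlt (not_lt.2 (mul_nonneg m.cast_nonneg (hneg m hm)))

/-- The mean of the first `2 ^ l` entries of `x`. -/
noncomputable def dyadicDensity (x : ℕ → ℝ) (l : ℕ) : ℝ :=
  (∑ k ∈ Finset.Icc 1 (2 ^ l), x k) / 2 ^ l

lemma dyadicDensity_mem_Icc {x : ℕ → ℝ} (hx : ∀ k, x k ∈ Set.Icc (0 : ℝ) 1) (l : ℕ) :
    dyadicDensity x l ∈ Set.Icc (0 : ℝ) 1 := by
  constructor
  · exact div_nonneg (Finset.sum_nonneg fun k _ => (hx k).1) (by positivity)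
  · rw [dyadicDensity, div_le_one (by positivity)]
    calc ∑ k ∈ Finset.Icc 1 (2 ^ l), x k ≤ ∑ _k ∈ Finset.Icc 1 (2 ^ l), 1 :=
          Finset.sum_le_sum fun k _ => (hx k).2
      _ = 2 ^ l := by simp

/-- The surprisal per entry under the constant bias `t` of a word of length `2 ^ (l + 1)` with
density `α'` whose first half has density `α`. -/
noncomputable def homogeneousRate (t α α' : ℝ) : ℝ :=
  -Real.log (1 - t) * (1 - α' - α / 2) - Real.log t * α'

lemma surprisal_const_two_pow (t : ℝ) (x : ℕ → ℝ) (l : ℕ) :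
    surprisal (fun _ => t) x (2 ^ (l + 1)) =
      2 ^ (l + 1) * homogeneousRate t (dyadicDensity x l) (dyadicDensity x (l + 1)) := by
  have hspread : ∑ k ∈ Finset.Icc 1 (2 ^ (l + 1)), spread x k =
      ∑ k ∈ Finset.Icc 1 (2 ^ l), x k := by
    rw [sum_Icc_spread, pow_succ, Nat.mul_div_cancel _ two_pos]
  rw [surprisal, Finset.sum_add_distrib, ← Finset.sum_mul, ← Finset.sum_mul,
    Finset.sum_sub_distrib, hspread, homogeneousRate, dyadicDensity, dyadicDensity]
  simp only [Finset.sum_const, Nat.card_Icc, Nat.add_sub_cancel, nsmul_eq_mul, mul_one,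
    Nat.cast_pow, Nat.cast_ofNat]
  field_simp
  ring

lemma abs_log_add_sub_le {x δ : ℝ} (hx : 0 < x) (hδ : |δ| ≤ x / 2) :
    |Real.log (x + δ) - Real.log x - δ / x| ≤ 2 * δ ^ 2 / x ^ 2 := by
  have hhalf : |-(δ / x)| ≤ 1 / 2 := by
    rw [abs_neg, abs_div, abs_of_pos hx, div_le_iff₀ hx]
    linarith
  have hlog : Real.log (1 - -(δ / x)) = Real.log (x + δ) - Real.log x := by
    rw [← Real.log_div (by linarith [(abs_le.1 hδ).1]) hx.ne', add_div, div_self hx.ne',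
      sub_neg_eq_add]
  have htaylor := Real.abs_log_sub_add_sum_range_le (hhalf.trans_lt one_half_lt_one) 1
  rw [Finset.sum_range_one, hlog] at htaylor
  calc |Real.log (x + δ) - Real.log x - δ / x|
      = |(-(δ / x)) ^ (0 + 1) / ((0 : ℕ) + 1) + (Real.log (x + δ) - Real.log x)| := by
        congr 1
        push_cast
        ring
    _ ≤ |-(δ / x)| ^ (1 + 1) / (1 - |-(δ / x)|) := htaylor
    _ ≤ |-(δ / x)| ^ (1 + 1) / (1 / 2) := by gcongr; linarith
    _ = 2 * δ ^ 2 / x ^ 2 := by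
        rw [sq_abs]
        ring

lemma homogeneousRate_le {p : ℝ} (hp : p ^ 3 = (1 - p) ^ 2) {δ : ℝ} (hδ : |δ| ≤ (1 - p) / 2)
    {α α' : ℝ} (hα : α ∈ Set.Icc 0 1) (hα' : α' ∈ Set.Icc 0 1) :
    homogeneousRate (1 - p - δ) α α' ≤
      -Real.log p + (-Real.log p / 2 - δ / (2 * p)) * (α' - α) -
        δ * ((3 / (2 * p) + 1 / (1 - p)) * (stationaryMean (1 - p) - α')) +
        (2 / p ^ 2 + 2 / (1 - p) ^ 2) * δ ^ 2 := by
  obtain ⟨hp_half, hp1⟩ := mem_Ioo_of_cube_eq hp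
  have hp0 : 0 < p := by linarith
  have hq0 : 0 < 1 - p := sub_pos.2 hp1
  have hzeroDigit := abs_le.1 (abs_log_add_sub_le hp0 (δ := δ) (by linarith))
  have honeDigit := abs_le.1 (abs_log_add_sub_le hq0 (δ := -δ) (by rwa [abs_neg]))
  rw [log_one_sub_of_cube_eq hp] at honeDigit
  have hweight : |1 - α' - α / 2| ≤ 1 := by
    rw [abs_le]
    constructor <;> linarith [hα.1, hα.2, hα'.1, hα'.2]
  have herror : -(Real.log (p + δ) - Real.log p - δ / p) * (1 - α' - α / 2) ≤
      2 * δ ^ 2 / p ^ 2 :=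
    (le_abs_self _).trans <| by
      rw [abs_mul, abs_neg]
      exact (mul_le_mul (abs_le.2 hzeroDigit) hweight (abs_nonneg _) (by positivity)).trans_eq
        (mul_one _)
  have herror' : -(Real.log (1 - p + -δ) - 3 / 2 * Real.log p - -δ / (1 - p)) * α' ≤
      2 * δ ^ 2 / (1 - p) ^ 2 := by
    rw [neg_sq] at honeDigit
    nlinarith [hα'.1, hα'.2, show 0 ≤ 2 * δ ^ 2 / (1 - p) ^ 2 by positivity]
  have hstat : (3 / (2 * p) + 1 / (1 - p)) * stationaryMean (1 - p) = 1 / p := by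
    have : 2 + (1 - p) ≠ 0 := by positivity
    rw [stationaryMean]
    field_simp
    ring
  rw [homogeneousRate, show 1 - (1 - p - δ) = p + δ by ring, sub_eq_add_neg (1 - p) δ,
    mul_sub (_ + _), hstat]
  calc _ = -Real.log p * (1 - α' - α / 2) - 3 / 2 * Real.log p * α' -
        δ / p * (1 - α' - α / 2) + δ / (1 - p) * α' +
        -(Real.log (p + δ) - Real.log p - δ / p) * (1 - α' - α / 2) +
        -(Real.log (1 - p + -δ) - 3 / 2 * Real.log p - -δ / (1 - p)) * α' := by ring
    _ ≤ -Real.log p * (1 - α' - α / 2) - 3 / 2 * Real.log p * α' -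
        δ / p * (1 - α' - α / 2) + δ / (1 - p) * α' + 2 * δ ^ 2 / p ^ 2 +
        2 * δ ^ 2 / (1 - p) ^ 2 := by linarith
    _ = _ := by
        field_simp
        ring

lemma exists_riccati_of_lt_homogeneousRate {p : ℝ} (hp : p ^ 3 = (1 - p) ^ 2) :
    ∃ K C : ℝ, ∀ᶠ x : ℝ in atTop, ∀ α ∈ Set.Icc (0 : ℝ) 1, ∀ α' ∈ Set.Icc (0 : ℝ) 1,
      (∀ δ : ℝ, |δ| = K / x → -Real.log p + C / x ^ 2 < homogeneousRate (1 - p - δ) α α') →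
      1 / x ^ 2 + 2 * |stationaryMean (1 - p) - α'| / x ≤ α' - α := by
  obtain ⟨hp_half, hp1⟩ := mem_Ioo_of_cube_eq hp
  have hp0 : 0 < p := by linarith
  have hq0 : 0 < 1 - p := sub_pos.2 hp1
  set L := -Real.log p with hL
  have hL0 : 0 < L := neg_pos.2 (Real.log_neg hp0 hp1)
  set κ := 3 / (2 * p) + 1 / (1 - p) with hκ
  have hκ0 : 0 < κ := by positivity
  set D := 2 / p ^ 2 + 2 / (1 - p) ^ 2 with hD
  set K := 2 * L / κ with hK
  have hsmall : ∀ᶠ x : ℝ in atTop, K / x < min ((1 - p) / 2) (L * p) :=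
    (tendsto_const_nhds.div_atTop tendsto_id).eventually (gt_mem_nhds (by positivity))
  refine ⟨K, D * K ^ 2 + L, ?_⟩
  filter_upwards [hsmall, eventually_gt_atTop 0] with x hKx hx α hα α' hα' hpoor
  rw [lt_min_iff] at hKx
  set β := stationaryMean (1 - p) - α'
  obtain ⟨δ, hδ, hδβ⟩ : ∃ δ : ℝ, |δ| = K / x ∧ δ * β = K / x * |β| := by
    have hnonneg : 0 ≤ K / x := by positivity
    rcases le_total 0 β with hβ | hβ
    · exact ⟨K / x, abs_of_nonneg hnonneg, by rw [abs_of_nonneg hβ]⟩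
    · exact ⟨-(K / x), by rw [abs_neg, abs_of_nonneg hnonneg], by rw [abs_of_nonpos hβ]; ring⟩
  have hrate := (hpoor δ hδ).trans_le (homogeneousRate_le hp (hδ.trans_le hKx.1.le) hα hα')
  have hsq : D * δ ^ 2 = D * K ^ 2 / x ^ 2 := by
    rw [← sq_abs, hδ]
    ring
  have hgain : δ * (κ * β) = L * (2 * |β| / x) := by
    rw [mul_left_comm, hδβ, hK]
    field_simp
  have hprod : L * (1 / x ^ 2 + 2 * |β| / x) < (L / 2 - δ / (2 * p)) * (α' - α) := by
    rw [← hL, ← hκ, ← hD, hgain, hsq, add_div] at hrate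
    rw [mul_add, mul_one_div]
    linarith
  have hcoeff : |δ / (2 * p)| ≤ L / 2 := by
    rw [abs_div, hδ, abs_of_pos (by positivity : 0 < 2 * p), div_le_iff₀ (by positivity)]
    linarith [hKx.2]
  obtain ⟨hcoeff0, hcoeff1⟩ := abs_le.1 hcoeff
  have hincr : 0 < α' - α :=
    pos_of_mul_pos_right ((by positivity : 0 ≤ L * (1 / x ^ 2 + 2 * |β| / x)).trans_lt hprod)
      (by linarith)
  refine le_of_mul_le_mul_left (hprod.le.trans ?_) hL0
  gcongr
  linarith

lemma exists_frequently_surprisal_le {p : ℝ} (hp : p ^ 3 = (1 - p) ^ 2) :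
    ∃ K C : ℝ, ∀ x : ℕ → ℝ, (∀ k, x k ∈ Set.Icc (0 : ℝ) 1) → ∃ᶠ m : ℕ in atTop, ∃ δ : ℝ,
      |δ| = K / m ∧
        surprisal (fun _ => 1 - p - δ) x (2 ^ m) ≤ 2 ^ m * (-Real.log p + C / m ^ 2) := by
  obtain ⟨K, C, hKC⟩ := exists_riccati_of_lt_homogeneousRate hp
  refine ⟨K, C, fun x hx hpoor => ?_⟩
  set β : ℕ → ℝ := fun m => stationaryMean (1 - p) - dyadicDensity x m
  have hlim : Tendsto β atTop atBot := by
    refine tendsto_atBot_of_riccati ?_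
    filter_upwards [(tendsto_add_atTop_nat 1).eventually hpoor,
      (tendsto_natCast_atTop_atTop.comp (tendsto_add_atTop_nat 1)).eventually hKC]
      with m hm hriccati
    push Not at hm
    have hstep := hriccati _ (dyadicDensity_mem_Icc hx m) _ (dyadicDensity_mem_Icc hx (m + 1))
      fun δ hδ => by
        have hlt := hm δ hδ
        rw [surprisal_const_two_pow] at hlt
        exact lt_of_mul_lt_mul_left hlt (by positivity)
    rw [Function.comp_apply, Nat.cast_succ] at hstep
    exact hstep.trans_eq (sub_sub_sub_cancel_left _ _ _).symm
  obtain ⟨m, hm⟩ := (hlim.eventually_lt_atBot (stationaryMean (1 - p) - 1)).exists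
  linarith [(dyadicDensity_mem_Icc hx m).2, show β m = _ - dyadicDensity x m from rfl]

lemma wordCode_lt (a : ℕ → Bool) (n : ℕ) : wordCode a n < 2 ^ n := by
  induction n with
  | zero => simp [wordCode]
  | succ n ih =>
    rw [wordCode, pow_succ]
    have := Bool.toNat_lt (a (n + 1))
    omega

lemma measurable_wordCode_goldenDigit (n : ℕ) : Measurable fun b => wordCode (goldenDigit b) n := by
  induction n with
  | zero => exact measurable_const
  | succ n ih =>
    exact (ih.const_mul 2).add ((measurable_of_countable Bool.toNat).comp
      (measurable_of_dependsOn (dependsOn_goldenDigit (n + 1))))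

open scoped Classical in
/-- The codes of the golden words of length `n` whose surprisal under the constant bias `t` is at
most `B`. -/
noncomputable def predictableWords (t B : ℝ) (n : ℕ) : Finset ℕ :=
  {c ∈ Finset.range (2 ^ n) | ∃ a, IsGolden a ∧ wordCode a n = c ∧
    surprisal (fun _ => t) (digitVal a) n ≤ B}

lemma mem_predictableWords {t B : ℝ} {n c : ℕ} : c ∈ predictableWords t B n ↔
    ∃ a, IsGolden a ∧ wordCode a n = c ∧ surprisal (fun _ => t) (digitVal a) n ≤ B := by
  simp only [predictableWords, Finset.mem_filter, Finset.mem_range, and_iff_right_iff_imp]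
  rintro ⟨a, -, rfl, -⟩
  exact wordCode_lt a n

lemma card_predictableWords_le {t : ℝ} (ht : t ∈ Set.Ioo 0 1) (B : ℝ) (n : ℕ) :
    ((predictableWords t B n).card : ℝ) ≤ Real.exp B := by
  set h : ℕ → unitInterval := fun _ => ⟨t, Set.Ioo_subset_Icc_self ht⟩
  have hmass (c : ℕ) (hc : c ∈ predictableWords t B n) : ENNReal.ofReal (Real.exp (-B)) ≤
      bitMeasure h ((fun b => wordCode (goldenDigit b) n) ⁻¹' {c}) := by
    obtain ⟨a, ha, rfl, haB⟩ := mem_predictableWords.1 hc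
    have hprefix : (fun b => wordCode (goldenDigit b) n) ⁻¹' {wordCode a n} =
        {b | ∀ k ≤ n, goldenDigit b k = a k} := by
      ext b
      exact wordCode_eq_iff (by rw [goldenDigit_zero, ha.apply_zero]) n
    rw [hprefix, bitMeasure_goldenDigit_prefix (h := h) (fun _ => ht) ha n]
    exact ENNReal.ofReal_le_ofReal (Real.exp_le_exp.2 (neg_le_neg haB))
  have htotal : ENNReal.ofReal ((predictableWords t B n).card * Real.exp (-B)) ≤ 1 := by
    calc ENNReal.ofReal ((predictableWords t B n).card * Real.exp (-B))
        = (predictableWords t B n).card • ENNReal.ofReal (Real.exp (-B)) := by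
          rw [← nsmul_eq_mul, ENNReal.ofReal_nsmul]
      _ ≤ ∑ c ∈ predictableWords t B n,
            bitMeasure h ((fun b => wordCode (goldenDigit b) n) ⁻¹' {c}) :=
          Finset.card_nsmul_le_sum _ _ _ hmass
      _ = bitMeasure h ((fun b => wordCode (goldenDigit b) n) ⁻¹' predictableWords t B n) :=
          sum_measure_preimage_singleton _ fun c _ =>
            measurable_wordCode_goldenDigit n (measurableSet_singleton c)
      _ ≤ 1 := prob_le_one
  rwa [ENNReal.ofReal_le_one, Real.exp_neg, ← div_eq_mul_inv, div_le_one (Real.exp_pos _)]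
    at htotal

lemma eventually_card_predictableWords_union_le {q : ℝ} (hq : q ∈ Set.Ioo 0 1) {ε : ℕ → ℝ}
    (hε : Tendsto ε atTop (𝓝 0)) (B : ℕ → ℝ) (n : ℕ → ℕ) : ∀ᶠ m in atTop,
    ((predictableWords (q - ε m) (B m) (n m) ∪ predictableWords (q + ε m) (B m) (n m)).card : ℝ) ≤
      2 * Real.exp (B m) := by
  have hsub : Tendsto (fun m => q - ε m) atTop (𝓝 q) := by simpa using hε.const_sub q
  have hadd : Tendsto (fun m => q + ε m) atTop (𝓝 q) := by simpa using hε.const_add q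
  filter_upwards [hsub.eventually (Ioo_mem_nhds hq.1 hq.2),
    hadd.eventually (Ioo_mem_nhds hq.1 hq.2)] with m hsub hadd
  calc _ ≤ ((predictableWords (q - ε m) (B m) (n m)).card : ℝ) +
        (predictableWords (q + ε m) (B m) (n m)).card := by
        exact_mod_cast Finset.card_union_le _ _
    _ ≤ Real.exp (B m) + Real.exp (B m) :=
        add_le_add (card_predictableWords_le hsub _ _) (card_predictableWords_le hadd _ _)
    _ = 2 * Real.exp (B m) := (two_mul _).symm

section BorelCantelli

variable {X : Type*} [EMetricSpace X] [MeasurableSpace X] [BorelSpace X] {g : ℝ≥0∞ → ℝ≥0∞}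
  {A : Set X}

lemma mkMetric_eq_zero_of_frequently_mem {ι : Type*} [Countable ι] {U : ι → Set X}
    (hdiam : Tendsto (fun i => Metric.ediam (U i)) cofinite (𝓝 0))
    (hsum : ∑' i, g (Metric.ediam (U i)) ≠ ∞) (hA : ∀ x ∈ A, ∃ᶠ i in cofinite, x ∈ U i) :
    Measure.mkMetric g A = 0 := by
  have hsup : Tendsto (fun s : Finset ι => ⨆ i : {i // i ∉ s}, Metric.ediam (U i)) atTop
      (𝓝 0) := by
    refine ENNReal.tendsto_nhds_zero.2 fun ε hε => ?_
    have hfinite : {i | ¬ Metric.ediam (U i) ≤ ε}.Finite :=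
      ENNReal.tendsto_nhds_zero.1 hdiam ε hε
    filter_upwards [eventually_ge_atTop hfinite.toFinset] with s hs
    refine iSup_le fun i => ?_
    by_contra hi
    exact i.2 (hs (hfinite.mem_toFinset.2 hi))
  have hle := Measure.mkMetric_le_liminf_tsum A _ hsup
    (fun s (i : {i // i ∉ s}) => U i) (Eventually.of_forall fun s i =>
      le_iSup (fun i : {i // i ∉ s} => Metric.ediam (U i)) i)
    (Eventually.of_forall fun s x hx => by
      obtain ⟨i, hxi, his⟩ := ((hA x hx).and_eventually s.eventually_cofinite_notMem).exists
      exact Set.mem_iUnion.2 ⟨⟨i, his⟩, hxi⟩) g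
  rw [(ENNReal.tendsto_tsum_compl_atTop_zero hsum).liminf_eq] at hle
  exact nonpos_iff_eq_zero.1 hle

lemma mkMetric_eq_zero_of_frequently_exists_mem {κ : Type*} [Countable κ] {T : ℕ → Finset κ}
    {U : ℕ → κ → Set X} {d : ℕ → ℝ≥0∞} (hd : Tendsto d atTop (𝓝 0))
    (hdiam : ∀ m c, Metric.ediam (U m c) = d m) (hsum : ∑' m, (T m).card * g (d m) ≠ ∞)
    (hA : ∀ x ∈ A, ∃ᶠ m in atTop, ∃ c ∈ T m, x ∈ U m c) : Measure.mkMetric g A = 0 := by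
  refine mkMetric_eq_zero_of_frequently_mem (ι := Σ m, T m) (U := fun i => U i.1 i.2) ?_ ?_ ?_
  · simp only [hdiam]
    rw [← Nat.cofinite_eq_atTop] at hd
    refine hd.comp (Tendsto.cofinite_of_finite_preimage_singleton fun m => ?_)
    refine (Set.finite_range fun c : T m => (⟨m, c⟩ : Σ m, T m)).subset ?_
    rintro ⟨_, c⟩ rfl
    exact Set.mem_range_self c
  · simpa [hdiam, ENNReal.tsum_sigma'] using hsum
  · intro x hx
    have hinfinite := Nat.frequently_atTop_iff_infinite.1 (hA x hx)
    refine frequently_cofinite_iff_infinite.2 (Set.Infinite.of_image Sigma.fst (hinfinite.mono ?_))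
    rintro m ⟨c, hc, hxc⟩
    exact ⟨⟨m, c, hc⟩, hxc, rfl⟩

end BorelCantelli

lemma gaugeMeasure_eq_zero_of_frequently_mem_Icc {φ : ℝ → ℝ} {A : Set ℝ} {n : ℕ → ℕ}
    (hn : Tendsto n atTop atTop) {T : ℕ → Finset ℕ}
    (hsum : Summable fun m => (T m).card * φ (1 / 2 ^ n m))
    (hA : ∀ x ∈ A, ∃ᶠ m in atTop, ∃ c ∈ T m,
      x ∈ Set.Icc ((c : ℝ) / 2 ^ n m) ((c + 1 : ℝ) / 2 ^ n m)) : gaugeMeasure φ A = 0 := by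
  refine mkMetric_eq_zero_of_frequently_exists_mem
    (U := fun m (c : ℕ) => Set.Icc ((c : ℝ) / 2 ^ n m) ((c + 1 : ℝ) / 2 ^ n m))
    (d := fun m => ENNReal.ofReal (1 / 2 ^ n m)) ?_ (fun m c => ?_) ?_ hA
  · rw [← ENNReal.ofReal_zero]
    simp only [← one_div_pow]
    exact ENNReal.tendsto_ofReal ((tendsto_pow_atTop_nhds_zero_of_lt_one (by norm_num)
      (by norm_num)).comp hn)
  · rw [Real.ediam_Icc, add_div, add_sub_cancel_left]
  · refine ne_of_eq_of_ne (tsum_congr fun m => ?_) hsum.tsum_ofReal_ne_top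
    rw [ENNReal.toReal_ofReal (by positivity), ENNReal.ofReal_mul (Nat.cast_nonneg _),
      ENNReal.ofReal_natCast]

lemma eventually_div_sq_le (C : ℝ) {θ : ℝ} (hθ : θ < 2) : ∀ᶠ m : ℕ in atTop,
    C / m ^ 2 ≤ Real.log 2 / Real.log (2 ^ m * Real.log 2) ^ θ := by
  have hlog2 : 0 < Real.log 2 := Real.log_pos one_lt_two
  have hlim : Tendsto (fun m : ℕ => Real.log (2 ^ m * Real.log 2)) atTop atTop :=
    Real.tendsto_log_atTop.comp
      ((tendsto_pow_atTop_atTop_of_one_lt one_lt_two).atTop_mul_const hlog2)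
  filter_upwards [eventually_gt_atTop 0, hlim.eventually_gt_atTop 0,
    ((tendsto_rpow_atTop (sub_pos.2 hθ)).comp hlim).eventually_ge_atTop (C / Real.log 2)]
    with m hm hx hlarge
  rw [Function.comp_apply] at hlarge
  set x := Real.log (2 ^ m * Real.log 2)
  have hm0 : (0 : ℝ) < m := Nat.cast_pos.2 hm
  have hlog2_lt : Real.log 2 < 1 := by linarith [Real.log_two_lt_d9]
  have hxm : x ≤ m := by
    calc x ≤ Real.log (2 ^ m) :=
          Real.log_le_log (by positivity) (mul_le_of_le_one_right (by positivity) hlog2_lt.le)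
      _ = m * Real.log 2 := Real.log_pow 2 m
      _ ≤ m := mul_le_of_le_one_right hm0.le hlog2_lt.le
  rw [div_le_div_iff₀ (by positivity) (by positivity)]
  calc C * x ^ θ = Real.log 2 * (C / Real.log 2) * x ^ θ := by field_simp
    _ ≤ Real.log 2 * x ^ (2 - θ) * x ^ θ := by gcongr
    _ = Real.log 2 * x ^ 2 := by
        rw [mul_assoc, ← Real.rpow_add hx, sub_add_cancel, Real.rpow_two]
    _ ≤ Real.log 2 * m ^ 2 := by gcongr

lemma eventually_add_one_le_two_pow_div_sq :
    ∀ᶠ m : ℕ in atTop, (m : ℝ) + 1 ≤ 2 ^ m / (m : ℝ) ^ 2 := by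
  have hlim : Tendsto (fun m : ℕ => (m : ℝ) ^ 3 / (2 : ℝ) ^ m) atTop (𝓝 0) :=
    tendsto_pow_const_div_const_pow_of_one_lt 3 one_lt_two
  filter_upwards [hlim.eventually_le_const (show (0 : ℝ) < 1 / 2 by norm_num),
    eventually_ge_atTop 1] with m hm hm1
  have hm1' : (1 : ℝ) ≤ m := by exact_mod_cast hm1
  rw [div_le_iff₀ (by positivity)] at hm
  rw [le_div_iff₀ (by positivity)]
  nlinarith [sq_nonneg (m : ℝ)]

lemma psiGauge_one_div_two_pow (L θ : ℝ) (n : ℕ) :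
    psiGauge (L / Real.log 2) θ (1 / 2 ^ n) =
      Real.exp (-(n * (L + Real.log 2 / Real.log (n * Real.log 2) ^ θ))) := by
  have hlog : Real.log (1 / 2 ^ n) = -(n * Real.log 2) := by
    rw [one_div, Real.log_inv, Real.log_pow]
  rw [psiGauge, hlog, abs_neg, abs_of_nonneg (by positivity), Real.rpow_def_of_pos (by positivity),
    hlog, ← Real.exp_add]
  congr 1
  field_simp
  ring

lemma eventually_exp_mul_psiGauge_le (L C : ℝ) {θ : ℝ} (hθ : θ < 2) :
    ∀ᶠ m : ℕ in atTop, 2 * Real.exp (2 ^ m * (L + C / m ^ 2)) *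
      psiGauge (L / Real.log 2) θ (1 / 2 ^ 2 ^ m) ≤ (1 / 2) ^ m := by
  filter_upwards [eventually_div_sq_le (C + 1) hθ, eventually_add_one_le_two_pow_div_sq]
    with m hgauge hpow
  rw [psiGauge_one_div_two_pow, Nat.cast_pow, Nat.cast_ofNat]
  set G := Real.log 2 / Real.log (2 ^ m * Real.log 2) ^ θ
  have hexponent : 2 ^ m * (L + C / m ^ 2) - 2 ^ m * (L + G) ≤ -((m + 1 : ℕ) * Real.log 2) := by
    calc 2 ^ m * (L + C / m ^ 2) - 2 ^ m * (L + G) = 2 ^ m * (C / m ^ 2 - G) := by ring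
      _ ≤ 2 ^ m * (C / m ^ 2 - (C + 1) / m ^ 2) := by gcongr
      _ = -(2 ^ m / m ^ 2) := by ring
      _ ≤ -((m + 1 : ℕ) * Real.log 2) := by
          have hlog2 : Real.log 2 ≤ 1 := by linarith [Real.log_two_lt_d9]
          push_cast
          exact neg_le_neg ((mul_le_of_le_one_right (by positivity) hlog2).trans hpow)
  calc 2 * Real.exp (2 ^ m * (L + C / m ^ 2)) * Real.exp (-(2 ^ m * (L + G)))
      = 2 * Real.exp (2 ^ m * (L + C / m ^ 2) - 2 ^ m * (L + G)) := by
        rw [mul_assoc, ← Real.exp_add, sub_eq_add_neg]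
    _ ≤ 2 * Real.exp (-((m + 1 : ℕ) * Real.log 2)) := by gcongr
    _ = (1 / 2) ^ m := by
        rw [← Real.log_pow, Real.exp_neg, Real.exp_log (by positivity), pow_succ, one_div_pow]
        field_simp

lemma gaugeMeasure_psiGauge_XiG_eq_zero {p : ℝ} (hp : p ^ 3 = (1 - p) ^ 2) {θ : ℝ} (hθ : θ < 2) :
    gaugeMeasure (psiGauge (-Real.logb 2 p) θ) XiG = 0 := by
  obtain ⟨hp0, hp1⟩ := mem_Ioo_of_cube_eq hp
  obtain ⟨K, C, hfreq⟩ := exists_frequently_surprisal_le hp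
  set B : ℕ → ℝ := fun m => 2 ^ m * (-Real.log p + C / m ^ 2)
  refine gaugeMeasure_eq_zero_of_frequently_mem_Icc
    (tendsto_pow_atTop_atTop_of_one_lt one_lt_two)
    (T := fun m => predictableWords (1 - p - K / m) (B m) (2 ^ m) ∪
      predictableWords (1 - p + K / m) (B m) (2 ^ m)) ?_ ?_
  · have hgauge (t : ℝ) (ht : 0 ≤ t) : 0 ≤ psiGauge (-Real.logb 2 p) θ t :=
      mul_nonneg (Real.rpow_nonneg ht _) (Real.exp_pos _).le
    refine Summable.of_norm_bounded_eventually_nat summable_geometric_two ?_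
    filter_upwards [eventually_card_predictableWords_union_le (q := 1 - p)
      ⟨by linarith, by linarith⟩ (tendsto_const_nhds.div_atTop tendsto_natCast_atTop_atTop) B _,
      eventually_exp_mul_psiGauge_le (-Real.log p) C hθ] with m hcard hsmall
    rw [neg_div] at hsmall
    rw [Real.norm_of_nonneg (mul_nonneg (Nat.cast_nonneg _) (hgauge _ (by positivity)))]
    exact (mul_le_mul_of_nonneg_right hcard (hgauge _ (by positivity))).trans hsmall
  · rw [XiG_eq_image]
    rintro _ ⟨a, ha, rfl⟩
    refine (hfreq (digitVal a) (digitVal_mem_Icc a)).mono fun m => ?_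
    rintro ⟨δ, hδ, hle⟩
    refine ⟨wordCode a (2 ^ m), Finset.mem_union.2 ?_, binaryReal_mem_Icc a _⟩
    rcases eq_or_eq_neg_of_abs_eq hδ with rfl | rfl
    · exact Or.inl (mem_predictableWords.2 ⟨a, ha, rfl, hle⟩)
    · rw [sub_neg_eq_add] at hle
      exact Or.inr (mem_predictableWords.2 ⟨a, ha, rfl, hle⟩)

theorem theorem2 (p : ℝ) (hp0 : 0 < p) (hp1 : p < 1) (hp : p ^ 3 = (1 - p) ^ 2)
    (s : ℝ) (hs : s = (dimH XiG).toReal) :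
    (dimH XiG = ENNReal.ofReal s ∧ s = -Real.logb 2 p) ∧
    (Measure.hausdorffMeasure s XiG = ⊤ ∧
      ¬ SigmaFinite ((Measure.hausdorffMeasure s : Measure ℝ).restrict XiG)) ∧
    (∃ c₀ : ℝ, 0 < c₀ ∧ ∀ c : ℝ, 0 < c → c < c₀ →
      gaugeMeasure (phiGauge s c) XiG = ⊤ ∧
      ¬ SigmaFinite ((gaugeMeasure (phiGauge s c)).restrict XiG)) ∧
    (∀ θ : ℝ, θ < 2 → gaugeMeasure (psiGauge s θ) XiG = 0) := by
  obtain ⟨c₀, hc₀, hne⟩ := exists_phiGauge_ne_zero hp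
  have hpos : 0 < -Real.logb 2 p := neg_pos.2 (Real.logb_neg one_lt_two hp0 hp1)
  have hdim : dimH XiG = ENNReal.ofReal (-Real.logb 2 p) := by
    refine dimH_eq_of_gaugeMeasure_psiGauge_eq_zero hpos ?_
      (gaugeMeasure_psiGauge_XiG_eq_zero hp one_lt_two)
    rw [hausdorffMeasure_eq_gaugeMeasure hpos.le]
    exact hne 0 hc₀
  have hs' : s = -Real.logb 2 p := by rw [hs, hdim, ENNReal.toReal_ofReal hpos.le]
  have hσ (c : ℝ) (hc : c < c₀) :
      ¬ SigmaFinite ((gaugeMeasure (phiGauge (-Real.logb 2 p) c)).restrict XiG) := by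
    obtain ⟨c', hcc', hc'⟩ := exists_between hc
    exact not_sigmaFinite_phiGauge hpos.ne' hcc' (hne c' hc')
  rw [hs', hausdorffMeasure_eq_gaugeMeasure hpos.le]
  exact ⟨⟨hdim, rfl⟩, ⟨measure_eq_top_of_not_sigmaFinite (hσ 0 hc₀), hσ 0 hc₀⟩,
    ⟨c₀, hc₀, fun c _ hc => ⟨measure_eq_top_of_not_sigmaFinite (hσ c hc), hσ c hc⟩⟩,
    fun θ hθ => gaugeMeasure_psiGauge_XiG_eq_zero hp hθ⟩
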